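/- Let $\Omega\subset\mathbb C$ be a bounded convex domain (a nonempty bounded open convex set). For a bounded linear operator $A$ on a complex Hilbert space $H$, let $W(A)=\{\langle Ax,x\rangle : x\in H,\ \|x\|=1\}$ be its numerical range. Let $$C(\Omega):=\sup\{\|r(A)\| : \overline{W(A)}\subset\Omega,\ |r(z)|\le 1\ \ \forall z\in\Omega\},$$ where the supremum is over all complex Hilbert spaces $H$, all bounded linear operators $A$ on $H$ and all rational functions $r:\mathbb C\to\mathbb C$ satisfying the constraints, and let $$C_{cb}(\Omega):=\sup\{\|R(A)\| : \overline{W(A)}\subset\Omega,\ \|R(z)\|\le 1\ \ \forall z\in\Omega\},$$ where now $R$ runs over all rational functions with values in the complex $m\times n$ matrices, for all $m$ and $n$; here $\|R(z)\|$ is the operator norm from $\mathbb C^n$ to $\mathbb C^m$ (Euclidean norms), and $R(A)=(r_{ij}(A))_{i,j}$ is regarded as an operator from $H^n$ to $H^m$. For $\omega\in\Omega$ let $TV(\log|\sigma-\omega|)$ denote the total variation of $\sigma\mapsto\log|\sigma-\omega|$ as $\sigma$ runs once around the boundary $\partial\Omega$, and set $$\phi_\Omega:=\inf_{\omega\in\Omega}TV(\log|\sigma-\omega|).$$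 Then $$C(\Omega)\le C_{cb}(\Omega)\le 2+\pi+\phi_\Omega .$$ -/

import Mathlib

open scoped ENNReal Matrix.Norms.L2Operator

universe u

noncomputable section

namespace ConvexSpectral

/-- The numerical range `W(A)` of a bounded operator: all `⟨A x, x⟩` with `‖x‖ = 1`. -/
def numericalRange {H : Type u} [NormedAddCommGroup H] [InnerProductSpace ℂ H]
    (A : H →L[ℂ] H) : Set ℂ :=
  {z | ∃ x : H, ‖x‖ = 1 ∧ inner ℂ x (A x) = z}

/-- The rational function `r` (in lowest terms) has no pole in `Ω`. -/
def NoPoleOn (r : RatFunc ℂ) (Ω : Set ℂ) : Prop :=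
  ∀ z ∈ Ω, r.denom.eval z ≠ 0

/-- The value `r(z)` of a rational function at a point that is not a pole. -/
def ratEval (r : RatFunc ℂ) (z : ℂ) : ℂ :=
  r.eval (RingHom.id ℂ) z

/-- The rational function `r = p / q` (in lowest terms) of an operator, `r(A) = p(A) q(A)⁻¹`.
It is used only when no zero of `q` lies in the spectrum of `A`, so that `q(A)` is invertible. -/
def ratOp {H : Type u} [NormedAddCommGroup H] [InnerProductSpace ℂ H]
    (r : RatFunc ℂ) (A : H →L[ℂ] H) : H →L[ℂ] H :=
  Polynomial.aeval A r.num * Ring.inverse (Polynomial.aeval A r.denom)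

/-- The operator `Hⁿ → Hᵐ` given by an `m × n` matrix of operators on `H`, where `Hⁿ` and `Hᵐ` are
the Hilbert space direct sums: `(x_j)_j ↦ (∑ j, M i j x_j)_i`. -/
def matrixOp {H : Type u} [NormedAddCommGroup H] [InnerProductSpace ℂ H] {m n : ℕ}
    (M : Matrix (Fin m) (Fin n) (H →L[ℂ] H)) :
    PiLp 2 (fun _ : Fin n => H) →L[ℂ] PiLp 2 (fun _ : Fin m => H) :=
  ((PiLp.continuousLinearEquiv 2 ℂ (fun _ : Fin m => H)).symm : _ →L[ℂ] _) ∘L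
    ContinuousLinearMap.pi (fun i : Fin m => ∑ j : Fin n, M i j ∘L PiLp.proj 2 (fun _ : Fin n => H) j)

/-- The constant `C(Ω) ∈ [0, ∞]`: the supremum of `‖r(A)‖` over all complex Hilbert spaces `H`, all
bounded operators `A` on `H` with `closure (W(A)) ⊆ Ω`, and all rational functions `r`
with `|r| ≤ 1` on `Ω`. -/
def spectralConst (Ω : Set ℂ) : ℝ≥0∞ :=
  ⨆ (H : Type u) (_ : NormedAddCommGroup H) (_ : InnerProductSpace ℂ H) (_ : CompleteSpace H)
    (A : H →L[ℂ] H) (_ : closure (numericalRange A) ⊆ Ω)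
    (r : RatFunc ℂ) (_ : NoPoleOn r Ω) (_ : ∀ z ∈ Ω, ‖ratEval r z‖ ≤ 1),
    ‖ratOp r A‖ₑ

/-- The constant `C_cb(Ω) ∈ [0, ∞]`: the same supremum over all rational functions with
`m × n` matrix values, over all `m` and `n`. The norm of `R(z)` is the operator norm `ℂⁿ → ℂᵐ` for the
Euclidean norms, and `R(A)` acts from `Hⁿ` to `Hᵐ`. -/
def spectralConstCB (Ω : Set ℂ) : ℝ≥0∞ :=
  ⨆ (H : Type u) (_ : NormedAddCommGroup H) (_ : InnerProductSpace ℂ H) (_ : CompleteSpace H)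
    (A : H →L[ℂ] H) (_ : closure (numericalRange A) ⊆ Ω)
    (m : ℕ) (n : ℕ) (R : Matrix (Fin m) (Fin n) (RatFunc ℂ))
    (_ : ∀ i j, NoPoleOn (R i j) Ω)
    (_ : ∀ z ∈ Ω, ‖(R.map fun r => ratEval r z)‖ ≤ 1),
    ‖matrixOp (R.map fun r => ratOp r A)‖ₑ

/-- `γ : [0, 1] → ℂ` is a simple closed curve that runs once around the boundary of `Ω`. -/
structure IsBoundaryParam (Ω : Set ℂ) (γ : ℝ → ℂ) : Prop where
  continuousOn : ContinuousOn γ (Set.Icc 0 1)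
  closed : γ 0 = γ 1
  injOn : Set.InjOn γ (Set.Ico 0 1)
  image_eq : γ '' Set.Icc 0 1 = frontier Ω

/-- The total variation of `f` around `∂Ω`. Any two simple closed parametrizations of `∂Ω` differ by a
monotone change of parameter, a change of starting point and possibly orientation, so they all
give the same variation; the supremum just picks this common value. -/
def boundaryVariation (Ω : Set ℂ) (f : ℂ → ℝ) : ℝ≥0∞ :=
  ⨆ (γ : ℝ → ℂ) (_ : IsBoundaryParam Ω γ), eVariationOn (f ∘ γ) (Set.Icc 0 1)

/-- `φ_Ω`, the infimum over the points `ω` of `Ω` of the total variation of `log |σ - ω|` as `σ` runs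
around `∂Ω`. -/
def boundaryLogVariation (Ω : Set ℂ) : ℝ≥0∞ :=
  ⨅ ω ∈ Ω, boundaryVariation Ω (fun σ => Real.log ‖σ - ω‖)

end ConvexSpectral

end

/-!
The bound proved here is `C_cb(Ω) ≤ 3`. It suffices, because `3 ≤ 2 + π` and the variation term is
nonnegative. The inequality `C(Ω) ≤ C_cb(Ω)` is the case of `1 × 1` matrices.

Let `R` be a matrix valued rational function with `‖R‖ ≤ 1` on `Ω` and let `A` be an operator
whose numerical range has its closure in `Ω`. Following Crouzeix and Palencia, `R` is paired with
the Cauchy transform `G(z) = (2πi)⁻¹ ∫ R(σ)ᴴ (σ - z)⁻¹ dσ` of its adjoint over a convex curve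
close to `∂Ω`. Adding the Cauchy formula for `R` gives

  `R(A) + G(A)⋆ = ∫ R(σ) ⊗ μ(σ, A)`,  `μ(σ, A) = 2 Re ((2πi)⁻¹ (σ - A)⁻¹ dσ)`.

Since the numerical range lies to the left of each tangent line of the curve, `μ(σ, A)` is a
positive operator measure, of total mass `2`. Hence `‖R(A) + G(A)⋆‖ ≤ 2`, and the same estimate at
the points of `Ω` in place of `A` gives `‖G‖ ≤ ‖R‖ + 2 ≤ 3` on `Ω`. With `T = R(A)`,

  `T T⋆ T T⋆ = T (T⋆ + G(A)) T T⋆ - (R G R)(A) T⋆`,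

so the supremum `K` of all `‖R(A)‖`, for matrices of a fixed size, satisfies `K⁴ ≤ 2 K³ + 3 K²`,
that is, `(K - 3) (K + 1) ≤ 0`. It is finite by the Cauchy formula on a curve inside `Ω`.

Everything has to stay within rational functions, so integrals are replaced by Riemann sums: `G`
is a finite sum of simple poles, and the identities above hold up to an arbitrarily small error.
The nodes of the sums are points on the boundary of a convex neighbourhood `V` of `closure Ω`, in
equally spaced directions from a centre (`BoundarySampling`). Positivity survives the
discretization because the line through two neighbouring nodes leaves `closure Ω` on its left as
soon as the nodes are closer to each other than to `closure Ω` (`left_of_chord`). Convergence of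
the sums is proved in an arbitrary complex Banach algebra (`BoundarySampling.tendsto_sum_cauchy`).
It is applied in the bounded operators on `H`, and in the continuous functions on `closure Ω`,
where it becomes uniform convergence. The two estimates are `exists_conjugate`, the algebra of the
fourth powers is `norm_pow_four_le`, and they are put together in `norm_matrixOp_le_three`.
-/

namespace ConvexSpectral

open Filter Topology Finset

/-! ### Sampling the boundary of a convex set -/

/-- For each `N`, the points `p N 0, p N 1, …` run once around the boundary of `V`,
counterclockwise as seen from `w`, and return to the first one after `N` steps of length `O(1 /
N)`. That they wind once around `w` is expressed by the Riemann sums of `∫ dσ / (σ - w)`. -/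
structure BoundarySampling (V : Set ℂ) (w : ℂ) (p : ℕ → ℕ → ℂ) : Prop where
  mem_frontier : ∀ N j, p N j ∈ frontier V
  closed : ∀ N, 0 < N → p N N = p N 0
  step : ∃ L : ℝ, 0 ≤ L ∧ ∀ N j, 0 < N → ‖p N (j + 1) - p N j‖ ≤ L / N
  turning : ∀ N j, 3 ≤ N →
    0 < ((p N (j + 1) - w) * (starRingEnd ℂ) (p N j - w)).im
  winding : Tendsto (fun N => ∑ j ∈ range N, (p N (j + 1) - p N j) * (p N j - w)⁻¹) atTop
    (𝓝 (2 * Real.pi * Complex.I))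

/-- If `1 + v N j = exp (ℓ N j)` with `v N j = O(1 / N)`, then the logarithms `ℓ N j` may be
replaced by the increments `v N j` in a sum of `N` terms, the error being `O(1 / N)`. -/
theorem tendsto_sum_of_exp_eq_one_add {ℓ v : ℕ → ℕ → ℂ} {L : ℝ} {c : ℂ}
    (hv : ∀ N j, 0 < N → ‖v N j‖ ≤ L / N) (hexp : ∀ N j, 0 < N → Complex.exp (ℓ N j) = 1 + v N j)
    (him : ∀ N j, 3 ≤ N → |(ℓ N j).im| < Real.pi)
    (hsum : ∀ N, 0 < N → ∑ j ∈ range N, ℓ N j = c) :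
    Tendsto (fun N => ∑ j ∈ range N, v N j) atTop (𝓝 c) := by
  rw [tendsto_iff_norm_sub_tendsto_zero]
  have hlim : Tendsto (fun N : ℕ => L ^ 2 / N) atTop (𝓝 0) :=
    tendsto_const_div_atTop_nhds_zero_nat _
  refine squeeze_zero' (Eventually.of_forall fun _ => norm_nonneg _) ?_ hlim
  filter_upwards [eventually_ge_atTop 3, eventually_ge_atTop ⌈2 * L⌉₊] with N hN hNL
  have hN0 : 0 < N := by omega
  have hNR : (0 : ℝ) < N := by exact_mod_cast hN0
  have hsmall : L / N ≤ 1 / 2 := by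
    rw [div_le_iff₀ hNR]
    have := (Nat.le_ceil (2 * L)).trans (Nat.cast_le.2 hNL)
    linarith
  rw [← hsum N hN0, ← sum_sub_distrib]
  have hterm : ∀ j ∈ range N, ‖v N j - ℓ N j‖ ≤ (L / N) ^ 2 := by
    intro j _
    have hlog : ℓ N j = Complex.log (1 + v N j) := by
      rw [← hexp N j hN0, Complex.log_exp]
      · exact (abs_lt.1 (him N j hN)).1
      · exact (abs_lt.1 (him N j hN)).2.le
    have hv1 : ‖v N j‖ ≤ 1 / 2 := (hv N j hN0).trans hsmall
    rw [hlog, norm_sub_rev]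
    refine (Complex.norm_log_one_add_sub_self_le (by linarith)).trans ?_
    have h2 : (1 - ‖v N j‖)⁻¹ ≤ 2 := by
      rw [inv_le_comm₀ (by linarith) (by norm_num)]; linarith
    have h3 : ‖v N j‖ ^ 2 ≤ (L / N) ^ 2 := pow_le_pow_left₀ (norm_nonneg _) (hv N j hN0) 2
    nlinarith [sq_nonneg ‖v N j‖]
  refine (norm_sum_le_of_le _ hterm).trans (le_of_eq ?_)
  rw [sum_const, card_range, nsmul_eq_mul]
  field_simp

/-- The sampling is by the points where the rays from `w` in the directions `exp (2πij / N)` meet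
the boundary. In polar coordinates around `w` the boundary is the graph of the inverse of the
gauge, which is Lipschitz. -/
theorem exists_boundarySampling {V : Set ℂ} (hV : IsOpen V) (hc : Convex ℝ V)
    (hb : Bornology.IsBounded V) {w : ℂ} (hw : w ∈ V) : ∃ p, BoundarySampling V w p := by
  set S : Set ℂ := (Homeomorph.addLeft w) ⁻¹' V with hS
  have hSo : IsOpen S := hV.preimage (Homeomorph.addLeft w).continuous
  have hSc : Convex ℝ S := by
    have : S = (fun z => w + z) ⁻¹' V := rfl
    rw [this]; exact hc.translate_preimage_right w
  have hS0 : S ∈ 𝓝 (0 : ℂ) := hSo.mem_nhds (by simpa [hS] using hw)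
  obtain ⟨R, hR0, hR⟩ : ∃ R : ℝ, 0 < R ∧ S ⊆ Metric.closedBall 0 R := by
    obtain ⟨R, hR⟩ := hb.subset_closedBall w
    refine ⟨max R 1, by positivity, fun z hz => ?_⟩
    have := hR (show w + z ∈ V from hz)
    simp only [Metric.mem_closedBall, dist_self_add_left, dist_zero_right] at this ⊢
    exact this.trans (le_max_left _ _)
  obtain ⟨r, hr0, hr⟩ := Metric.mem_nhds_iff.1 hS0
  obtain ⟨K, hK⟩ := hSc.lipschitz_gauge hS0
  have habs : Absorbent ℝ S := absorbent_nhds_zero hS0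
  let e : ℝ → ℂ := fun θ => Complex.exp (θ * Complex.I)
  have he : ∀ θ, ‖e θ‖ = 1 := fun θ => Complex.norm_exp_ofReal_mul_I θ
  let g : ℝ → ℝ := fun θ => gauge S (e θ)
  have hglow : ∀ θ, 1 / R ≤ g θ := fun θ => by
    have := le_gauge_of_subset_closedBall habs hR0.le hR (x := e θ)
    rwa [he] at this
  have hgup : ∀ θ, g θ ≤ 1 / r := fun θ => by
    rw [le_div_iff₀ hr0, mul_comm]
    simpa [he] using mul_gauge_le_norm hr (x := e θ)
  have hgpos : ∀ θ, 0 < g θ := fun θ => lt_of_lt_of_le (by positivity) (hglow θ)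
  have hginv : ∀ θ, (g θ)⁻¹ ≤ R := fun θ => by
    rw [inv_le_comm₀ (hgpos θ) hR0, inv_eq_one_div]; exact hglow θ
  let v : ℝ → ℂ := fun θ => ((g θ)⁻¹ : ℝ) * e θ
  have hvne : ∀ θ, v θ ≠ 0 := fun θ =>
    mul_ne_zero (by exact_mod_cast (inv_pos.2 (hgpos θ)).ne') (Complex.exp_ne_zero _)
  have hvfr : ∀ θ, w + v θ ∈ frontier V := fun θ => by
    have h1 : gauge S (v θ) = 1 := by
      have : v θ = (g θ)⁻¹ • e θ := by simp [v]
      rw [this, gauge_smul_of_nonneg (inv_pos.2 (hgpos θ)).le, smul_eq_mul]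
      exact inv_mul_cancel₀ (hgpos θ).ne'
    have h2 := mem_frontier_of_gauge_eq_one hSc (mem_of_mem_nhds hS0) habs h1
    rwa [hS, ← Homeomorph.preimage_frontier] at h2
  -- The Lipschitz estimate for the boundary curve `v` follows from those for `e` and the gauge.
  have hee : ∀ θ θ', ‖e θ' - e θ‖ ≤ |θ' - θ| := fun θ θ' => by
    have : e θ' - e θ = e θ * (Complex.exp (Complex.I * ((θ' - θ : ℝ) : ℂ)) - 1) := by
      simp only [e]; rw [mul_sub, ← Complex.exp_add]; push_cast; ring_nf
    rw [this, norm_mul, he, one_mul]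
    exact Real.norm_exp_I_mul_ofReal_sub_one_le
  have hlip : ∀ θ θ', ‖v θ' - v θ‖ ≤ (R + R ^ 2 * K) * |θ' - θ| := fun θ θ' => by
    have h1 : v θ' - v θ = ((g θ')⁻¹ : ℝ) * (e θ' - e θ)
        + (((g θ')⁻¹ * (g θ)⁻¹ * (g θ - g θ') : ℝ) : ℂ) * e θ := by
      have a1 : (g θ : ℂ) ≠ 0 := by exact_mod_cast (hgpos θ).ne'
      have a2 : (g θ' : ℂ) ≠ 0 := by exact_mod_cast (hgpos θ').ne'
      simp only [v]; push_cast; field_simp; ring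
    have h2 : |g θ - g θ'| ≤ K * |θ' - θ| := by
      have := hK.dist_le_mul (e θ) (e θ')
      rw [Real.dist_eq, dist_comm, dist_eq_norm] at this
      exact this.trans (mul_le_mul_of_nonneg_left (hee θ θ') K.2)
    have i1 := hginv θ
    have i2 := hginv θ'
    have j1 := inv_pos.2 (hgpos θ)
    have j2 := inv_pos.2 (hgpos θ')
    rw [h1]
    refine (norm_add_le _ _).trans ?_
    rw [norm_mul, norm_mul, he, mul_one, Complex.norm_real, Complex.norm_real, Real.norm_eq_abs,
      Real.norm_eq_abs, abs_of_pos j2, abs_mul, abs_mul, abs_of_pos j1, abs_of_pos j2, add_mul]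
    refine add_le_add (mul_le_mul i2 (hee _ _) (norm_nonneg _) hR0.le) ?_
    rw [sq, mul_assoc (R * R)]
    exact mul_le_mul (mul_le_mul i2 i1 j1.le hR0.le) h2 (abs_nonneg _) (by positivity)
  let τ : ℕ → ℕ → ℝ := fun N j => 2 * Real.pi * j / N
  have hτ : ∀ N j, 0 < N → τ N (j + 1) - τ N j = 2 * Real.pi / N := fun N j hN => by
    simp only [τ]; push_cast; ring
  have hτN : ∀ N, 0 < N → e (τ N N) = e (τ N 0) := fun N hN => by
    have : (N : ℂ) ≠ 0 := by exact_mod_cast hN.ne'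
    simp only [e, τ]; push_cast
    rw [mul_div_assoc, div_self this]
    simp [Complex.exp_two_pi_mul_I]
  have hstep : ∀ N j, 0 < N → ‖v (τ N (j + 1)) - v (τ N j)‖
      ≤ ((R + R ^ 2 * K) * (2 * Real.pi)) / N := fun N j hN => by
    refine (hlip _ _).trans (le_of_eq ?_)
    rw [hτ N j hN, abs_of_nonneg (by positivity)]; ring
  refine ⟨fun N j => w + v (τ N j), fun N j => hvfr _, fun N hN => ?_,
    ⟨(R + R ^ 2 * K) * (2 * Real.pi), by positivity, fun N j hN => by simpa using hstep N j hN⟩,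
    fun N j hN => ?_, ?_⟩
  · simp only [v, g, hτN N hN]
  · have hN0 : 0 < N := by omega
    have hNR : (3 : ℝ) ≤ N := by exact_mod_cast hN
    have h1 : (w + v (τ N (j + 1)) - w) * (starRingEnd ℂ) (w + v (τ N j) - w)
        = (((g (τ N (j + 1)))⁻¹ * (g (τ N j))⁻¹ : ℝ) : ℂ)
          * Complex.exp ((2 * Real.pi / N : ℝ) * Complex.I) := by
      rw [← hτ N j hN0, add_sub_cancel_left, add_sub_cancel_left]
      simp only [v, e, map_mul, Complex.conj_ofReal, ← Complex.exp_conj, Complex.conj_I]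
      rw [mul_mul_mul_comm, ← Complex.exp_add]
      push_cast; ring_nf
    rw [h1, Complex.im_ofReal_mul, Complex.exp_ofReal_mul_I_im]
    refine mul_pos (mul_pos (inv_pos.2 (hgpos _)) (inv_pos.2 (hgpos _)))
      (Real.sin_pos_of_pos_of_lt_pi (by positivity) ?_)
    rw [div_lt_iff₀ (by positivity)]
    nlinarith [Real.pi_pos]
  · refine tendsto_sum_of_exp_eq_one_add
      (ℓ := fun N j => ((Real.log (g (τ N j)) - Real.log (g (τ N (j + 1))) : ℝ) : ℂ)
        + (2 * Real.pi / N : ℝ) * Complex.I)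
      (L := (R + R ^ 2 * K) * (2 * Real.pi) * (1 / r)) ?_ ?_ ?_ ?_
    · intro N j hN
      have h2 : ‖(v (τ N j))⁻¹‖ = g (τ N j) := by
        simp only [v, norm_inv, norm_mul, he, mul_one, Complex.norm_real, Real.norm_eq_abs,
          inv_inv, abs_of_pos (hgpos _)]
      rw [add_sub_add_left_eq_sub, add_sub_cancel_left, norm_mul, h2, mul_div_right_comm]
      exact mul_le_mul (hstep N j hN) (hgup _) (hgpos _).le (by positivity)
    · intro N j hN
      have h3 : 1 + (w + v (τ N (j + 1)) - (w + v (τ N j))) * (w + v (τ N j) - w)⁻¹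
          = v (τ N (j + 1)) / v (τ N j) := by
        have := hvne (τ N j)
        rw [add_sub_add_left_eq_sub, add_sub_cancel_left]; field_simp; ring
      rw [h3, Complex.exp_add, ← Complex.ofReal_exp, Real.exp_sub, Real.exp_log (hgpos _),
        Real.exp_log (hgpos _), ← hτ N j hN]
      have a1 : (g (τ N j) : ℂ) ≠ 0 := by exact_mod_cast (hgpos _).ne'
      have a2 : (g (τ N (j + 1)) : ℂ) ≠ 0 := by exact_mod_cast (hgpos _).ne'
      have h4 : e (τ N (j + 1)) = e (τ N j)
          * Complex.exp (((τ N (j + 1) - τ N j : ℝ) : ℂ) * Complex.I) := by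
        simp only [e]; rw [← Complex.exp_add]; push_cast; ring_nf
      have h5 : e (τ N j) ≠ 0 := Complex.exp_ne_zero _
      simp only [v]; rw [h4]; push_cast; field_simp
    · intro N j hN
      have hNR : (3 : ℝ) ≤ N := by exact_mod_cast hN
      have : (((Real.log (g (τ N j)) - Real.log (g (τ N (j + 1))) : ℝ) : ℂ)
        + (2 * Real.pi / N : ℝ) * Complex.I).im = 2 * Real.pi / N := by
        rw [Complex.add_im, Complex.ofReal_im, zero_add, Complex.im_ofReal_mul, Complex.I_im,
          mul_one]
      rw [this, abs_of_nonneg (by positivity), div_lt_iff₀ (by positivity)]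
      nlinarith [Real.pi_pos]
    · intro N hN
      have hNC : (N : ℂ) ≠ 0 := by exact_mod_cast hN.ne'
      rw [sum_add_distrib, ← Complex.ofReal_sum,
        sum_range_sub' (fun j => Real.log (g (τ N j))), sum_const, card_range]
      simp only [g, hτN N hN, sub_self]
      push_cast
      rw [nsmul_eq_mul]; field_simp; ring

/-! ### Chords, Riemann sums and the Cauchy formula -/

/-- The discrete form of the fact that a convex set lies to the left of the tangent lines of its
boundary: if two boundary points `p`, `p'` of `V` are closer to each other than `p` is to `C ⊆ V`,
then the line through them does not meet `C`, because it meets `V` only between `p` and `p'`. The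
side on which `C` lies is decided at the point `w`. -/
theorem left_of_chord {V C : Set ℂ} (hV : IsOpen V) (hVc : Convex ℝ V) (hC : Convex ℝ C)
    (hCV : C ⊆ V) {w p p' : ℂ} (hw : w ∈ C) (hp : p ∈ frontier V) (hp' : p' ∈ frontier V)
    (hd : ∀ z ∈ C, ‖p' - p‖ < ‖z - p‖)
    (hturn : 0 < ((p' - w) * (starRingEnd ℂ) (p - w)).im) :
    ∀ z ∈ C, 0 < ((z - p) * (starRingEnd ℂ) (p' - p)).im := by
  have hΔ : p' - p ≠ 0 := by
    intro h
    rw [sub_eq_zero] at h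
    rw [h, Complex.mul_conj, Complex.ofReal_im] at hturn
    exact lt_irrefl _ hturn
  have hpV : p ∉ V := fun h => by
    have := hp.2; rw [hV.interior_eq] at this; exact this h
  have hpV' : p' ∉ V := fun h => by
    have := hp'.2; rw [hV.interior_eq] at this; exact this h
  have hseg : ∀ x y t : ℂ, x ∈ V → y ∈ closure V → (∃ s : ℝ, 0 < s ∧ s < 1 ∧
      t = x + s * (y - x)) → t ∈ V := by
    rintro x y t hx hy ⟨s, hs0, hs1, rfl⟩
    have := hVc.openSegment_interior_closure_subset_interior
      (by rwa [hV.interior_eq]) hy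
      (show x + s * (y - x) ∈ openSegment ℝ x y from
        ⟨1 - s, s, by linarith, hs0, by ring, by
          simp only [Complex.real_smul]; push_cast; ring⟩)
    rwa [hV.interior_eq] at this
  -- A point `z = p + l (p' - p)` of `C` on the line has `|l| > 1`, so one of the points `p` and
  -- `p'` lies strictly between `z` and the other, hence in the interior of `V`.
  have hne : ∀ z ∈ C, ((z - p) * (starRingEnd ℂ) (p' - p)).im ≠ 0 := by
    intro z hz h0
    have hns : (0 : ℝ) < Complex.normSq (p' - p) := Complex.normSq_pos.2 hΔ
    set l : ℝ := ((z - p) * (starRingEnd ℂ) (p' - p)).re / Complex.normSq (p' - p) with hl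
    have hzl : z - p = l * (p' - p) := by
      have h1 : (z - p) * (starRingEnd ℂ) (p' - p)
          = ((((z - p) * (starRingEnd ℂ) (p' - p)).re : ℝ) : ℂ) := by
        apply Complex.ext <;> simp only [Complex.ofReal_re, Complex.ofReal_im, h0]
      have h2 : ((Complex.normSq (p' - p) : ℝ) : ℂ) ≠ 0 := by exact_mod_cast hns.ne'
      have h3 : (z - p) * (Complex.normSq (p' - p) : ℝ)
          = ((((z - p) * (starRingEnd ℂ) (p' - p)).re : ℝ) : ℂ) * (p' - p) := by
        rw [← Complex.mul_conj, mul_comm (p' - p), ← mul_assoc, ← h1]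
      rw [hl, Complex.ofReal_div, div_mul_eq_mul_div, eq_div_iff h2, h3]
    have habs : 1 < |l| := by
      have := hd z hz
      rw [hzl, norm_mul, Complex.norm_real, Real.norm_eq_abs] at this
      exact (lt_mul_iff_one_lt_left (norm_pos_iff.2 hΔ)).1 this
    rcases lt_abs.1 habs with h | h
    · refine hpV' (hseg z p p' (hCV hz) hp.1 ⟨1 - l⁻¹, ?_, ?_, ?_⟩)
      · have := inv_lt_one_of_one_lt₀ h; linarith
      · have : 0 < l⁻¹ := inv_pos.2 (by linarith)
        linarith
      · have hlC : (l : ℂ) ≠ 0 := by exact_mod_cast (by linarith : l ≠ 0)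
        have h4 : p' = p + (l : ℂ)⁻¹ * (z - p) := by rw [hzl]; field_simp; ring
        conv_lhs => rw [h4]
        push_cast; ring
    · refine hpV (hseg z p' p (hCV hz) hp'.1 ⟨(1 - l)⁻¹ * (-l), ?_, ?_, ?_⟩)
      · exact mul_pos (inv_pos.2 (by linarith)) (by linarith)
      · rw [inv_mul_lt_iff₀ (by linarith)]; linarith
      · have hlC : (1 - l : ℂ) ≠ 0 := by exact_mod_cast (by linarith : 1 - l ≠ 0)
        have h4 : z = p + l * (p' - p) := by rw [← hzl]; ring
        rw [h4]; push_cast; field_simp; ring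
  -- Both sides are twice the signed area of the triangle with the vertices `w`, `p`, `p'`.
  have hwpos : 0 < ((w - p) * (starRingEnd ℂ) (p' - p)).im := by
    have : ((w - p) * (starRingEnd ℂ) (p' - p)).im
        = ((p' - w) * (starRingEnd ℂ) (p - w)).im := by
      simp only [Complex.mul_im, Complex.conj_re, Complex.conj_im, Complex.sub_re, Complex.sub_im]
      ring
    rwa [this]
  intro z hz
  by_contra hcon
  push Not at hcon
  have hcont : ContinuousOn (fun x : ℂ => ((x - p) * (starRingEnd ℂ) (p' - p)).im) C := by
    fun_prop
  obtain ⟨x, hx, hx0⟩ := hC.isPreconnected.intermediate_value hz hw hcont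
    (show (0 : ℝ) ∈ Set.Icc _ _ from ⟨hcon, hwpos.le⟩)
  exact hne x hx hx0

section Riemann

variable {V U : Set ℂ} {w : ℂ} {p : ℕ → ℕ → ℂ}

theorem BoundarySampling.sum_norm_step_le (hp : BoundarySampling V w p) :
    ∃ L : ℝ, ∀ N, 0 < N → ∑ j ∈ range N, ‖p N (j + 1) - p N j‖ ≤ L := by
  obtain ⟨L, _, hL⟩ := hp.step
  refine ⟨L, fun N hN => (sum_le_sum fun j _ => hL N j hN).trans (le_of_eq ?_)⟩
  have : (N : ℝ) ≠ 0 := by exact_mod_cast hN.ne'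
  rw [sum_const, card_range, nsmul_eq_mul]; field_simp

theorem BoundarySampling.eventually_step_lt (hp : BoundarySampling V w p) {δ : ℝ} (hδ : 0 < δ) :
    ∀ᶠ N in atTop, ∀ j, ‖p N (j + 1) - p N j‖ < δ := by
  obtain ⟨L, _, hL⟩ := hp.step
  filter_upwards [(tendsto_const_div_atTop_nhds_zero_nat L).eventually (gt_mem_nhds hδ),
    eventually_gt_atTop 0] with N hN hN0 j
  exact (hL N j hN0).trans_lt hN

/-- Cauchy's theorem for the Riemann sums of a holomorphic function: they are compared with the
increments of a primitive, which telescope to zero. -/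
theorem BoundarySampling.tendsto_sum_smul_zero {E : Type*} [NormedAddCommGroup E] [NormedSpace ℂ E]
    [CompleteSpace E] (hp : BoundarySampling V w p) (hVc : Convex ℝ V)
    (hVb : Bornology.IsBounded V) (hUc : Convex ℝ U) (hVU : closure V ⊆ U)
    {φ : ℂ → E} (hφ : DifferentiableOn ℂ φ U) :
    Tendsto (fun N => ∑ j ∈ range N, (p N (j + 1) - p N j) • φ (p N j)) atTop (𝓝 0) := by
  obtain ⟨g, hg⟩ := hUc.exists_forall_hasDerivWithinAt hφ
  have hK : IsCompact (closure V) := hVb.isCompact_closure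
  have huc := hK.uniformContinuousOn_of_continuous (hφ.continuousOn.mono hVU)
  obtain ⟨L, hL⟩ := hp.sum_norm_step_le
  rw [Metric.tendsto_nhds]
  intro ε hε
  have hL0 : 0 ≤ L := (sum_nonneg fun _ _ => norm_nonneg _).trans (hL 1 one_pos)
  set η : ℝ := ε / (L + 1) with hη
  have hη0 : 0 < η := by positivity
  obtain ⟨δ, hδ, hδφ⟩ := Metric.uniformContinuousOn_iff.1 huc η hη0
  filter_upwards [hp.eventually_step_lt hδ, eventually_gt_atTop 0] with N hN hN0
  have hterm : ∀ j ∈ range N, ‖(p N (j + 1) - p N j) • φ (p N j)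
      - (g (p N (j + 1)) - g (p N j))‖ ≤ η * ‖p N (j + 1) - p N j‖ := by
    intro j _
    have hpj := (hp.mem_frontier N j).1
    have hpj' := (hp.mem_frontier N (j + 1)).1
    have hconv : Convex ℝ (closure V ∩ Metric.ball (p N j) δ) :=
      hVc.closure.inter (convex_ball _ _)
    have hder : ∀ x ∈ closure V ∩ Metric.ball (p N j) δ,
        HasDerivWithinAt (fun x => x • φ (p N j) - g x) (φ (p N j) - φ x)
          (closure V ∩ Metric.ball (p N j) δ) x := by
      intro x hx
      have h1 := (hg x (hVU hx.1)).mono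
        (show closure V ∩ Metric.ball (p N j) δ ⊆ U from fun y hy => hVU hy.1)
      have h2 := ((hasDerivWithinAt_id x (closure V ∩ Metric.ball (p N j) δ)).smul_const
        (φ (p N j))).sub h1
      rw [one_smul] at h2
      exact h2
    have := hconv.norm_image_sub_le_of_norm_hasDerivWithin_le (C := η) hder
      (fun x hx => by
        rw [← dist_eq_norm]
        exact (hδφ _ hpj x hx.1 (by rw [dist_comm]; exact hx.2)).le)
      ⟨hpj, Metric.mem_ball_self hδ⟩ ⟨hpj', by rw [Metric.mem_ball, dist_eq_norm]; exact hN j⟩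
    refine le_trans (le_of_eq ?_) this
    congr 1
    rw [sub_smul]; abel
  have htel : ∑ j ∈ range N, (g (p N (j + 1)) - g (p N j)) = 0 := by
    rw [sum_range_sub (fun j => g (p N j)), hp.closed N hN0, sub_self]
  rw [dist_zero_right, ← sub_zero (∑ j ∈ range N, _), ← htel, ← sum_sub_distrib]
  calc _ ≤ ∑ j ∈ range N, η * ‖p N (j + 1) - p N j‖ := norm_sum_le_of_le _ hterm
    _ ≤ η * L := by rw [← mul_sum]; exact mul_le_mul_of_nonneg_left (hL N hN0) hη0.le
    _ < ε := by rw [hη, div_mul_eq_mul_div, div_lt_iff₀ (by linarith)]; nlinarith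

variable {E : Type*} [NormedRing E] [NormedAlgebra ℂ E] [CompleteSpace E]

omit [NormedAlgebra ℂ E] in
theorem exists_norm_ringInverse_le {X : Type*} [TopologicalSpace X] {K : Set X} (hK : IsCompact K)
    {f : X → E} (hf : Continuous f) (hu : ∀ x ∈ K, IsUnit (f x)) :
    ∃ M : ℝ, ∀ x ∈ K, ‖Ring.inverse (f x)‖ ≤ M := by
  refine hK.exists_bound_of_continuousOn fun x hx => ?_
  obtain ⟨v, hv⟩ := hu x hx
  have h1 : ContinuousAt Ring.inverse (f x) := by
    rw [← hv]; exact NormedRing.inverse_continuousAt v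
  exact (h1.comp hf.continuousAt).continuousWithinAt

/-- The limit of the Riemann sums of `∫ (σ - a)⁻¹ dσ` is `2πi`. The element `a` is contracted to
the centre: with `a` replaced by `w + s (a - w)`, the derivative of the sums in `s` tends to zero
uniformly, by the resolvent identity, and at `s = 0` they are scalar. -/
theorem BoundarySampling.tendsto_sum_resolvent (hp : BoundarySampling V w p)
    (hVb : Bornology.IsBounded V) {a : E}
    (ha : ∀ z ∈ frontier V, ∀ s ∈ Set.Icc (0 : ℝ) 1,
      IsUnit (algebraMap ℂ E (z - w) - (s : ℂ) • (a - algebraMap ℂ E w))) :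
    Tendsto (fun N => ∑ j ∈ range N, (p N (j + 1) - p N j) •
      Ring.inverse (algebraMap ℂ E (p N j) - a)) atTop
      (𝓝 ((2 * Real.pi * Complex.I : ℂ) • 1)) := by
  set b : E := a - algebraMap ℂ E w with hb
  let D : ℂ → ℝ → E := fun z s => algebraMap ℂ E (z - w) - (s : ℂ) • b
  let R : ℂ → ℝ → E := fun z s => Ring.inverse (D z s)
  have hfc : IsCompact (frontier V) :=
    hVb.isCompact_closure.of_isClosed_subset isClosed_frontier frontier_subset_closure
  have hDc : Continuous (fun q : ℂ × ℝ => D q.1 q.2) := by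
    simp only [D]
    exact ((algebraMapCLM ℂ E).continuous.comp (by fun_prop)).sub
      ((Complex.continuous_ofReal.comp continuous_snd).smul continuous_const)
  obtain ⟨M, hM⟩ : ∃ M : ℝ, ∀ z ∈ frontier V, ∀ s ∈ Set.Icc (0 : ℝ) 1, ‖R z s‖ ≤ M := by
    obtain ⟨M, hM⟩ := exists_norm_ringInverse_le (hfc.prod (isCompact_Icc (a := (0 : ℝ)) (b := 1)))
      hDc fun q hq => ha q.1 hq.1 q.2 hq.2
    exact ⟨M, fun z hz s hs => hM (z, s) ⟨hz, hs⟩⟩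
  obtain ⟨L, hL0, hL⟩ := hp.step
  let S : ℕ → ℝ → E := fun N s => ∑ j ∈ range N, (p N (j + 1) - p N j) • R (p N j) s
  have hcommb : ∀ z s, Commute b (R z s) := fun z s => by
    have h1 : Commute b (D z s) :=
      (show Commute b (algebraMap ℂ E (z - w)) from (Algebra.commutes (z - w) b).symm).sub_right
        ((Commute.refl b).smul_right _)
    by_cases hu : IsUnit (D z s)
    · obtain ⟨v, hv⟩ := hu
      simp only [R, ← hv, Ring.inverse_unit]
      exact (hv ▸ h1).units_inv_right
    · simp only [R, Ring.inverse_non_unit _ hu]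
      exact Commute.zero_right b
  have hderiv : ∀ N, ∀ s ∈ Set.Icc (0 : ℝ) 1, HasDerivWithinAt (S N)
      (∑ j ∈ range N, (p N (j + 1) - p N j) • (R (p N j) s * b * R (p N j) s))
      (Set.Icc 0 1) s := by
    intro N s hs
    refine HasDerivWithinAt.fun_sum fun j _ => HasDerivWithinAt.fun_const_smul _ ?_
    obtain ⟨v, hv⟩ := ha _ (hp.mem_frontier N j) s hs
    have h1 := hasFDerivAt_ringInverse (𝕜 := ℝ) v
    rw [hv] at h1
    have h2 : HasDerivAt (fun s : ℝ => D (p N j) s) (-b) s := by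
      have h3 := ((Complex.ofRealCLM.hasDerivAt (x := s)).smul_const b).const_sub
        (algebraMap ℂ E (p N j - w))
      simp only [Complex.ofRealCLM_apply, Complex.ofReal_one, one_smul] at h3
      exact h3
    have h4 := (h1.comp_hasDerivAt s h2).hasDerivWithinAt (s := Set.Icc 0 1)
    convert! h4 using 1
    have h5 : R (p N j) s = ↑v⁻¹ := by simp only [R, D, ← hv, Ring.inverse_unit]
    simp [h5]
  have hbound : ∀ N, 0 < N → ∀ s ∈ Set.Icc (0 : ℝ) 1,
      ‖∑ j ∈ range N, (p N (j + 1) - p N j) • (R (p N j) s * b * R (p N j) s)‖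
        ≤ L ^ 2 * M ^ 3 * ‖b‖ / N := by
    intro N hN s hs
    have hdiff : ∀ j, R (p N (j + 1)) s - R (p N j) s
        = -((p N (j + 1) - p N j) • (R (p N (j + 1)) s * R (p N j) s)) := by
      intro j
      obtain ⟨v, hv⟩ := ha _ (hp.mem_frontier N j) s hs
      obtain ⟨v', hv'⟩ := ha _ (hp.mem_frontier N (j + 1)) s hs
      have h5 : R (p N j) s = ↑v⁻¹ := by simp only [R, D, ← hv, Ring.inverse_unit]
      have h6 : R (p N (j + 1)) s = ↑v'⁻¹ := by simp only [R, D, ← hv', Ring.inverse_unit]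
      have h7 : (p N (j + 1) - p N j) • (1 : E) = v' - v := by
        rw [hv, hv', ← Algebra.algebraMap_eq_smul_one, sub_sub_sub_cancel_right, ← map_sub]
        congr 1; ring
      have h8 : (p N (j + 1) - p N j) • ((↑v'⁻¹ : E) * ↑v⁻¹)
          = ↑v'⁻¹ * ((p N (j + 1) - p N j) • (1 : E)) * ↑v⁻¹ := by
        rw [mul_smul_comm, mul_one, smul_mul_assoc]
      rw [h5, h6, h8, h7, mul_sub, sub_mul]
      simp [mul_assoc]
    -- By the resolvent identity these terms are differences, which telescope around the curve.
    have hzero : ∑ j ∈ range N, (p N (j + 1) - p N j) • (R (p N (j + 1)) s * R (p N j) s) = 0 := by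
      have : ∑ j ∈ range N, (R (p N (j + 1)) s - R (p N j) s) = 0 := by
        rw [sum_range_sub (fun j => R (p N j) s), hp.closed N hN, sub_self]
      simpa [hdiff] using this
    -- Subtracting the vanishing sum leaves a factor `R (p N j) s - R (p N (j + 1)) s`, which is
    -- of order `1 / N`.
    have hrew : ∑ j ∈ range N, (p N (j + 1) - p N j) • (R (p N j) s * b * R (p N j) s)
        = ∑ j ∈ range N, (p N (j + 1) - p N j) • ((p N (j + 1) - p N j) •
          (b * (R (p N (j + 1)) s * R (p N j) s * R (p N j) s))) := by
      have : ∑ j ∈ range N, (p N (j + 1) - p N j) • (R (p N j) s * b * R (p N j) s)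
          = ∑ j ∈ range N, (p N (j + 1) - p N j) • (R (p N j) s * b * R (p N j) s) - b *
            ∑ j ∈ range N, (p N (j + 1) - p N j) • (R (p N (j + 1)) s * R (p N j) s) := by
        rw [hzero, mul_zero, sub_zero]
      rw [this, mul_sum, ← sum_sub_distrib]
      refine sum_congr rfl fun j _ => ?_
      rw [mul_smul_comm, ← smul_sub]
      congr 1
      rw [← (hcommb (p N j) s).eq, mul_assoc, ← mul_sub, ← sub_mul]
      have := hdiff j
      rw [← neg_sub (R (p N (j + 1)) s), this, neg_neg, smul_mul_assoc, mul_smul_comm]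
    rw [hrew]
    have hM0 : 0 ≤ M := (norm_nonneg _).trans (hM _ (hp.mem_frontier 0 0) s hs)
    have hterm : ∀ j ∈ range N, ‖(p N (j + 1) - p N j) • ((p N (j + 1) - p N j) •
          (b * (R (p N (j + 1)) s * R (p N j) s * R (p N j) s)))‖
          ≤ (L / N) * ((L / N) * (‖b‖ * (M * M * M))) := by
      intro j _
      have r1 := hM _ (hp.mem_frontier N j) s hs
      have r2 := hM _ (hp.mem_frontier N (j + 1)) s hs
      have r3 := hL N j hN
      rw [norm_smul, norm_smul]
      have r4 : ‖b * (R (p N (j + 1)) s * R (p N j) s * R (p N j) s)‖ ≤ ‖b‖ * (M * M * M) := by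
        refine (norm_mul_le _ _).trans (mul_le_mul_of_nonneg_left ?_ (norm_nonneg _))
        refine (norm_mul_le _ _).trans (mul_le_mul ((norm_mul_le _ _).trans
          (mul_le_mul r2 r1 (norm_nonneg _) hM0)) r1 (norm_nonneg _) (by positivity))
      exact mul_le_mul r3 (mul_le_mul r3 r4 (norm_nonneg _) (by positivity)) (by positivity)
        (by positivity)
    refine (norm_sum_le_of_le _ hterm).trans (le_of_eq ?_)
    have : (N : ℝ) ≠ 0 := by exact_mod_cast hN.ne'
    rw [sum_const, card_range, nsmul_eq_mul]; field_simp
  have h01 : Tendsto (fun N => S N 1 - S N 0) atTop (𝓝 0) := by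
    refine squeeze_zero_norm' (a := fun N : ℕ => L ^ 2 * M ^ 3 * ‖b‖ / N) ?_
      (tendsto_const_div_atTop_nhds_zero_nat _)
    filter_upwards [eventually_gt_atTop 0] with N hN
    exact norm_image_sub_le_of_norm_deriv_le_segment_01' (hderiv N)
      (fun s hs => hbound N hN s ⟨hs.1, hs.2.le⟩)
  have h0 : Tendsto (fun N => S N 0) atTop (𝓝 ((2 * Real.pi * Complex.I : ℂ) • 1)) := by
    refine (hp.winding.smul_const (1 : E)).congr fun N => ?_
    simp only [S, R, D, Complex.ofReal_zero, zero_smul, sub_zero]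
    rw [sum_smul]
    refine sum_congr rfl fun j _ => ?_
    rw [mul_smul, ← Algebra.algebraMap_eq_smul_one]
    congr 1
    by_cases h : p N j - w = 0
    · rw [h]; simp
    · have hu : IsUnit (algebraMap ℂ E (p N j - w)) := (IsUnit.mk0 _ h).map (algebraMap ℂ E)
      refine hu.mul_left_cancel ?_
      rw [Ring.mul_inverse_cancel _ hu, ← map_mul, mul_inv_cancel₀ h, map_one]
  have h1 := h01.add h0
  rw [zero_add] at h1
  refine h1.congr fun N => ?_
  rw [sub_add_cancel]
  refine sum_congr rfl fun j _ => ?_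
  simp only [R, D, hb, Complex.ofReal_one, one_smul, map_sub]
  rw [sub_sub_sub_cancel_right]

omit [CompleteSpace E] in
theorem exists_divided_difference (a : E) (Q : Polynomial ℂ) :
    ∃ D : ℂ → E, Differentiable ℂ D ∧ ∀ σ,
      algebraMap ℂ E (Q.eval σ) - Polynomial.aeval a Q = (algebraMap ℂ E σ - a) * D σ := by
  induction Q using Polynomial.induction_on with
  | C c => exact ⟨fun _ => 0, by fun_prop, fun σ => by simp⟩
  | add P Q hP hQ =>
    obtain ⟨D, hD, h⟩ := hP
    obtain ⟨D', hD', h'⟩ := hQ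
    refine ⟨fun σ => D σ + D' σ, by fun_prop, fun σ => ?_⟩
    rw [mul_add, ← h, ← h']
    simp only [Polynomial.eval_add, map_add]; abel
  | monomial n c hn =>
    obtain ⟨D, hD, h⟩ := hn
    refine ⟨fun σ => (c * σ ^ n) • (1 : E) + a * D σ, by fun_prop, fun σ => ?_⟩
    have hcomm : Commute a (algebraMap ℂ E σ - a) :=
      (show Commute a (algebraMap ℂ E σ) from (Algebra.commutes σ a).symm).sub_right
        (Commute.refl a)
    have h2 : (algebraMap ℂ E σ - a) * (a * D σ)
        = a * (algebraMap ℂ E (Polynomial.eval σ (Polynomial.C c * Polynomial.X ^ n))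
          - Polynomial.aeval a (Polynomial.C c * Polynomial.X ^ n)) := by
      rw [h, ← mul_assoc, ← hcomm.eq, mul_assoc]
    rw [mul_add, h2, ← Algebra.algebraMap_eq_smul_one]
    simp only [Polynomial.eval_mul, Polynomial.eval_C, Polynomial.eval_pow, Polynomial.eval_X,
      map_mul, Polynomial.aeval_C, Polynomial.aeval_X, map_pow, pow_succ']
    have h3 := Algebra.commutes (R := ℂ) c a
    have h4 := Algebra.commutes (R := ℂ) σ a
    have h5 := Algebra.commutes (R := ℂ) σ (algebraMap ℂ E c)
    rw [mul_sub, sub_mul, ← mul_assoc a (algebraMap ℂ E c) (a ^ n), ← h3,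
      ← mul_assoc (algebraMap ℂ E σ) (algebraMap ℂ E c), h5]
    simp only [mul_assoc]
    abel

/-- Cauchy's formula for `P / Q` at the element `a`. After multiplication by `Q(a)` the
denominator can be moved inside the sums by `exists_divided_difference`, and what remains is
`tendsto_sum_resolvent` and a holomorphic function. -/
theorem BoundarySampling.tendsto_sum_cauchy (hp : BoundarySampling V w p) (hVc : Convex ℝ V)
    (hVb : Bornology.IsBounded V) (hUc : Convex ℝ U) (hVU : closure V ⊆ U) {a : E}
    (ha : ∀ z ∈ frontier V, ∀ s ∈ Set.Icc (0 : ℝ) 1,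
      IsUnit (algebraMap ℂ E (z - w) - (s : ℂ) • (a - algebraMap ℂ E w)))
    {P Q : Polynomial ℂ} (hQ : ∀ z ∈ U, Q.eval z ≠ 0) (hQa : IsUnit (Polynomial.aeval a Q)) :
    Tendsto (fun N => ∑ j ∈ range N, ((p N (j + 1) - p N j) * (P.eval (p N j) / Q.eval (p N j))) •
      Ring.inverse (algebraMap ℂ E (p N j) - a)) atTop
      (𝓝 ((2 * Real.pi * Complex.I : ℂ) •
        (Polynomial.aeval a P * Ring.inverse (Polynomial.aeval a Q)))) := by
  obtain ⟨DP, hDP, hP⟩ := exists_divided_difference a P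
  obtain ⟨DQ, hDQ, hQ'⟩ := exists_divided_difference a Q
  have hφ : DifferentiableOn ℂ (fun σ => DP σ - (P.eval σ / Q.eval σ) • DQ σ) U :=
    hDP.differentiableOn.sub ((P.differentiable.differentiableOn.div
      Q.differentiable.differentiableOn hQ).smul hDQ.differentiableOn)
  have h1 := hp.tendsto_sum_smul_zero hVc hVb hUc hVU hφ
  have h2 := ((hp.tendsto_sum_resolvent hVb ha).mul_const (Polynomial.aeval a P)).add h1
  have h3 := h2.mul_const (Ring.inverse (Polynomial.aeval a Q))
  rw [add_zero, smul_mul_assoc, one_mul, smul_mul_assoc] at h3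
  refine h3.congr fun N => ?_
  rw [sum_mul, ← sum_add_distrib, sum_mul]
  refine sum_congr rfl fun j _ => ?_
  set σ := p N j
  have hσ : IsUnit (algebraMap ℂ E σ - a) := by
    have := ha σ (hp.mem_frontier N j) 1 ⟨zero_le_one, le_rfl⟩
    simpa using this
  set B := Ring.inverse (algebraMap ℂ E σ - a)
  have hB : B * (algebraMap ℂ E σ - a) = 1 := Ring.inverse_mul_cancel _ hσ
  have haux : ∀ (c : ℂ) (x d : E), algebraMap ℂ E c - x = (algebraMap ℂ E σ - a) * d →
      B * x = c • B - d := by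
    intro c x d h
    have h' : B * (algebraMap ℂ E c - x) = d := by rw [h, ← mul_assoc, hB, one_mul]
    rw [mul_sub, ← Algebra.commutes, ← Algebra.smul_def] at h'
    rw [← h']; abel
  have hBP := haux _ _ _ (hP σ)
  have hBQ := haux _ _ _ (hQ' σ)
  have hQσ : Q.eval σ ≠ 0 := hQ _ (hVU (frontier_subset_closure (hp.mem_frontier N j)))
  have key : B * Polynomial.aeval a P + (DP σ - (P.eval σ / Q.eval σ) • DQ σ)
      = (P.eval σ / Q.eval σ) • (B * Polynomial.aeval a Q) := by
    rw [hBP, hBQ, smul_sub, smul_smul, div_mul_cancel₀ _ hQσ]; abel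
  rw [smul_mul_assoc, ← smul_add, key, smul_mul_assoc, smul_mul_assoc, mul_assoc,
    Ring.mul_inverse_cancel _ hQa, mul_one, smul_smul]

end Riemann

/-! ### Matrices of operators -/

section MatrixOp

variable {H : Type u} [NormedAddCommGroup H] [InnerProductSpace ℂ H] {l m n : ℕ}

theorem matrixOp_apply (M : Matrix (Fin m) (Fin n) (H →L[ℂ] H)) (x : PiLp 2 (fun _ : Fin n => H))
    (i : Fin m) : matrixOp M x i = ∑ j, M i j (x j) := by
  simp [matrixOp]

theorem matrixOp_add (M N : Matrix (Fin m) (Fin n) (H →L[ℂ] H)) :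
    matrixOp (M + N) = matrixOp M + matrixOp N := by
  ext x i
  simp [matrixOp_apply, sum_add_distrib]

theorem matrixOp_sum {ι : Type*} (s : Finset ι)
    (M : ι → Matrix (Fin m) (Fin n) (H →L[ℂ] H)) :
    matrixOp (∑ k ∈ s, M k) = ∑ k ∈ s, matrixOp (M k) :=
  map_sum (⟨⟨matrixOp, by ext x i; simp [matrixOp_apply]⟩, matrixOp_add⟩ :
    Matrix (Fin m) (Fin n) (H →L[ℂ] H) →+ _) M s

theorem matrixOp_mul (M : Matrix (Fin l) (Fin m) (H →L[ℂ] H))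
    (N : Matrix (Fin m) (Fin n) (H →L[ℂ] H)) :
    matrixOp (M * N) = matrixOp M ∘L matrixOp N := by
  ext x i
  simp only [matrixOp_apply, ContinuousLinearMap.comp_apply, Matrix.mul_apply, map_sum,
    _root_.sum_apply, mul_apply_eq_comp]
  rw [sum_comm]

theorem norm_matrixOp_le_sum (M : Matrix (Fin m) (Fin n) (H →L[ℂ] H)) :
    ‖matrixOp M‖ ≤ ∑ i, ∑ j, ‖M i j‖ := by
  refine ContinuousLinearMap.opNorm_le_bound _
    (sum_nonneg fun _ _ => sum_nonneg fun _ _ => norm_nonneg _) fun x => ?_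
  have h1 : matrixOp M x = ∑ i, PiLp.single 2 i (matrixOp M x i) := by
    ext k
    simp [Pi.single_apply]
  rw [h1, sum_mul]
  refine norm_sum_le_of_le _ fun i _ => ?_
  rw [PiLp.norm_single, matrixOp_apply, sum_mul]
  refine norm_sum_le_of_le _ fun j _ => ?_
  exact ((M i j).le_opNorm _).trans
    (mul_le_mul_of_nonneg_left (PiLp.norm_apply_le x j) (norm_nonneg _))

theorem norm_entry_le_norm_matrixOp (M : Matrix (Fin m) (Fin n) (H →L[ℂ] H)) (i : Fin m)
    (j : Fin n) : ‖M i j‖ ≤ ‖matrixOp M‖ := by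
  refine ContinuousLinearMap.opNorm_le_bound _ (norm_nonneg (matrixOp M)) fun x => ?_
  have h := (matrixOp M).le_opNorm (PiLp.single 2 j x : PiLp 2 fun _ : Fin n => H)
  rw [PiLp.norm_single] at h
  refine le_trans ?_ h
  refine le_trans (le_of_eq ?_) (PiLp.norm_apply_le _ i)
  rw [matrixOp_apply, sum_eq_single j]
  · simp
  · intro k _ hk
    simp [hk]
  · simp

variable [CompleteSpace H]

theorem adjoint_matrixOp (M : Matrix (Fin m) (Fin n) (H →L[ℂ] H)) :
    ContinuousLinearMap.adjoint (matrixOp M) = matrixOp M.conjTranspose := by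
  symm
  rw [ContinuousLinearMap.eq_adjoint_iff]
  intro x y
  simp only [PiLp.inner_apply, matrixOp_apply, sum_inner, inner_sum, Matrix.conjTranspose_apply,
    ContinuousLinearMap.star_eq_adjoint, ContinuousLinearMap.adjoint_inner_left]
  rw [sum_comm]

theorem norm_sq_matrixOp_apply (M : Matrix (Fin m) (Fin n) (H →L[ℂ] H))
    (x : PiLp 2 (fun _ : Fin n => H)) :
    (‖matrixOp M x‖ ^ 2 : ℝ) = (inner ℂ x (matrixOp (M.conjTranspose * M) x)).re := by
  rw [matrixOp_mul, ← adjoint_matrixOp]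
  exact ContinuousLinearMap.apply_norm_sq_eq_inner_adjoint_right (matrixOp M) x

open scoped MatrixOrder in
/-- A scalar matrix acts on `Hⁿ` with at most its norm on `ℂⁿ`: `‖X‖² - Xᴴ X` is of the form `Cᴴ
C`, hence acts as a positive operator on `Hⁿ`. -/
theorem norm_matrixOp_algebraMap_le (X : Matrix (Fin m) (Fin n) ℂ) :
    ‖matrixOp (X.map (algebraMap ℂ (H →L[ℂ] H)))‖ ≤ ‖X‖ := by
  have hle : X.conjTranspose * X ≤ algebraMap ℝ _ ‖X.conjTranspose * X‖ :=
    IsSelfAdjoint.le_algebraMap_norm_self (Matrix.isHermitian_conjTranspose_mul_self X)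
  obtain ⟨C, hC⟩ := CStarAlgebra.nonneg_iff_eq_star_mul_self.1 (sub_nonneg.2 hle)
  rw [Matrix.l2_opNorm_conjTranspose_mul_self, sub_eq_iff_eq_add, Matrix.star_eq_conjTranspose]
    at hC
  have hmap : ∀ {k : ℕ} (Y : Matrix (Fin k) (Fin n) ℂ),
      (Y.map (algebraMap ℂ (H →L[ℂ] H))).conjTranspose * Y.map (algebraMap ℂ (H →L[ℂ] H))
        = (Y.conjTranspose * Y).map (algebraMap ℂ (H →L[ℂ] H)) := by
    intro k Y
    rw [Matrix.map_mul]
    congr 1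
    ext i j : 2
    simp [Matrix.conjTranspose_apply, Algebra.algebraMap_eq_smul_one]
  refine ContinuousLinearMap.opNorm_le_bound _ (norm_nonneg _) fun x => ?_
  refine le_of_sq_le_sq ?_ (by positivity)
  have h1 := norm_sq_matrixOp_apply (X.map (algebraMap ℂ (H →L[ℂ] H))) x
  have h2 := norm_sq_matrixOp_apply (C.map (algebraMap ℂ (H →L[ℂ] H))) x
  rw [hmap] at h1 h2
  have h3 : matrixOp ((C.conjTranspose * C).map (algebraMap ℂ (H →L[ℂ] H))) x
      + matrixOp ((X.conjTranspose * X).map (algebraMap ℂ (H →L[ℂ] H))) x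
      = ((‖X‖ * ‖X‖ : ℝ) : ℂ) • x := by
    rw [← add_apply, ← matrixOp_add, ← Matrix.map_add _ (map_add _), ← hC,
      Algebra.algebraMap_eq_smul_one]
    ext i
    rw [matrixOp_apply, sum_eq_single i]
    · simp [Algebra.algebraMap_eq_smul_one]
    · intro j _ hj
      simp [hj.symm]
    · simp
  have h4 : (inner ℂ x (((‖X‖ * ‖X‖ : ℝ) : ℂ) • x)).re = ‖X‖ * ‖X‖ * ‖x‖ ^ 2 := by
    rw [inner_smul_right, Complex.re_ofReal_mul]
    exact congrArg _ (inner_self_eq_norm_sq (𝕜 := ℂ) x)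
  rw [← h3, inner_add_right, Complex.add_re, ← h1, ← h2] at h4
  nlinarith [sq_nonneg ‖matrixOp (C.map (algebraMap ℂ (H →L[ℂ] H))) x‖]

/-- The Cauchy-Schwarz inequality for the positive operator valued measure with the atoms `P k`.
-/
theorem norm_matrixOp_sum_smul_le {ι : Type*} (s : Finset ι) (P : ι → H →L[ℂ] H)
    (hP : ∀ k ∈ s, 0 ≤ P k) (X : ι → Matrix (Fin m) (Fin n) ℂ) {β κ : ℝ} (hβ : 0 ≤ β)
    (hX : ∀ k ∈ s, ‖X k‖ ≤ β) (hκ : ‖∑ k ∈ s, P k‖ ≤ κ) :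
    ‖matrixOp (∑ k ∈ s, (X k).map fun c => c • P k)‖ ≤ β * κ := by
  classical
  have hex : ∀ k, ∃ S : H →L[ℂ] H, k ∈ s → P k = star S * S := fun k => by
    by_cases hk : k ∈ s
    · obtain ⟨S, hS⟩ := CStarAlgebra.nonneg_iff_eq_star_mul_self.1 (hP k hk)
      exact ⟨S, fun _ => hS⟩
    · exact ⟨0, fun h => absurd h hk⟩
  choose S hS using hex
  have hκ0 : 0 ≤ κ := (norm_nonneg _).trans hκ
  let D : ∀ r : ℕ, ι → Matrix (Fin r) (Fin r) (H →L[ℂ] H) :=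
    fun r k => Matrix.diagonal fun _ => S k
  have hDapp : ∀ {r : ℕ} (k : ι) (x : PiLp 2 (fun _ : Fin r => H)) (i : Fin r),
      matrixOp (D r k) x i = S k (x i) := by
    intro r k x i
    rw [matrixOp_apply, sum_eq_single i]
    · simp [D]
    · intro j _ hj; simp [D, hj.symm]
    · simp
  have hDsum : ∀ {r : ℕ} (x : PiLp 2 (fun _ : Fin r => H)),
      ∑ k ∈ s, ‖matrixOp (D r k) x‖ ^ 2 ≤ κ * ‖x‖ ^ 2 := by
    intro r x
    have h1 : ∀ k ∈ s, ‖matrixOp (D r k) x‖ ^ 2 = ∑ i, (inner ℂ (x i) (P k (x i))).re := by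
      intro k hk
      rw [PiLp.norm_sq_eq_of_L2]
      refine sum_congr rfl fun i _ => ?_
      rw [hDapp, hS k hk]
      exact ContinuousLinearMap.apply_norm_sq_eq_inner_adjoint_right (S k) (x i)
    rw [sum_congr rfl h1, sum_comm, PiLp.norm_sq_eq_of_L2, mul_sum]
    refine sum_le_sum fun i _ => ?_
    rw [← Complex.re_sum, ← inner_sum, ← _root_.sum_apply]
    refine (Complex.re_le_norm _).trans ((norm_inner_le_norm _ _).trans ?_)
    have := ((∑ k ∈ s, P k).le_opNorm (x i)).trans
      (mul_le_mul_of_nonneg_right hκ (norm_nonneg _))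
    nlinarith [norm_nonneg (x i)]
  have hfac : ∀ k ∈ s, (X k).map (fun c => c • P k)
      = (D m k).conjTranspose * (X k).map (algebraMap ℂ (H →L[ℂ] H)) * D n k := by
    intro k hk
    ext i j : 2
    simp [D, hS k hk, Matrix.diagonal_conjTranspose, Matrix.diagonal_mul, Matrix.mul_diagonal,
      Algebra.algebraMap_eq_smul_one]
  refine ContinuousLinearMap.opNorm_le_of_re_inner_le (mul_nonneg hβ hκ0) fun x y hx hy => ?_
  have hterm : ∀ k ∈ s, RCLike.re (inner ℂ (matrixOp ((X k).map fun c => c • P k) x) y)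
      ≤ β * (‖matrixOp (D n k) x‖ * ‖matrixOp (D m k) y‖) := by
    intro k hk
    rw [hfac k hk, matrixOp_mul, matrixOp_mul, ← adjoint_matrixOp, ContinuousLinearMap.comp_apply,
      ContinuousLinearMap.comp_apply, ContinuousLinearMap.adjoint_inner_left]
    refine (RCLike.re_le_norm _).trans ((norm_inner_le_norm _ _).trans ?_)
    rw [← mul_assoc]
    refine mul_le_mul_of_nonneg_right ?_ (norm_nonneg _)
    exact (ContinuousLinearMap.le_opNorm _ _).trans (mul_le_mul_of_nonneg_right
      ((norm_matrixOp_algebraMap_le _).trans (hX k hk)) (norm_nonneg _))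
  rw [matrixOp_sum, _root_.sum_apply, sum_inner, map_sum]
  refine (sum_le_sum hterm).trans ?_
  rw [← mul_sum]
  refine mul_le_mul_of_nonneg_left ?_ hβ
  refine (Real.sum_mul_le_sqrt_mul_sqrt _ _ _).trans ?_
  refine (mul_le_mul (Real.sqrt_le_sqrt (hDsum x)) (Real.sqrt_le_sqrt (hDsum y))
    (Real.sqrt_nonneg _) (Real.sqrt_nonneg _)).trans (le_of_eq ?_)
  rw [hx, hy, one_pow, mul_one, Real.mul_self_sqrt hκ0]

end MatrixOp

/-! ### Rational functions of an element of an algebra, and the numerical range -/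

section RationalCalculus

open Polynomial

variable {E : Type*} [Ring E] [Algebra ℂ E]

/-- The value `num(a) denom(a)⁻¹` of a rational function in lowest terms at an element `a` of an
algebra. It specializes to `ratOp` for operators and to `ratEval` for complex numbers. It is
meaningful for `r ∈ regularAt a`. -/
noncomputable def ratAt (a : E) (r : RatFunc ℂ) : E :=
  aeval a r.num * Ring.inverse (aeval a r.denom)

theorem isUnit_aeval_of_dvd {a : E} {P Q : ℂ[X]} (h : P ∣ Q) (hQ : IsUnit (aeval a Q)) :
    IsUnit (aeval a P) := by
  obtain ⟨S, rfl⟩ := h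
  rw [map_mul,
    Commute.isUnit_mul_iff (by rw [commute_iff_eq, ← map_mul, ← map_mul, mul_comm])] at hQ
  exact hQ.1

theorem ratAt_eq_of_mul_eq {a : E} {r : RatFunc ℂ} {P Q : ℂ[X]} (hr : IsUnit (aeval a r.denom))
    (hQ : IsUnit (aeval a Q)) (h : r.num * Q = P * r.denom) :
    ratAt a r = aeval a P * Ring.inverse (aeval a Q) := by
  have hcomm : ∀ S T : ℂ[X], aeval a S * aeval a T = aeval a T * aeval a S := fun S T => by
    rw [← map_mul, ← map_mul, mul_comm]
  refine hQ.mul_right_cancel (hr.mul_right_cancel ?_)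
  rw [ratAt, mul_assoc (aeval a P), Ring.inverse_mul_cancel _ hQ, mul_one, ← map_mul, ← h, map_mul,
    mul_assoc, hcomm Q, mul_assoc, ← mul_assoc (Ring.inverse _), Ring.inverse_mul_cancel _ hr,
    one_mul]

theorem num_mul_eq_of_eq_div {r : RatFunc ℂ} {P Q : ℂ[X]} (hQ : Q ≠ 0)
    (h : r = algebraMap ℂ[X] (RatFunc ℂ) P / algebraMap ℂ[X] (RatFunc ℂ) Q) :
    r.num * Q = P * r.denom := by
  have h1 := r.num_div_denom
  rw [h, div_eq_div_iff
    ((map_ne_zero_iff _ (RatFunc.algebraMap_injective ℂ)).2 (RatFunc.denom_ne_zero _))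
    ((map_ne_zero_iff _ (RatFunc.algebraMap_injective ℂ)).2 hQ), ← map_mul, ← map_mul, ← h] at h1
  exact RatFunc.algebraMap_injective ℂ h1

theorem isUnit_aeval_denom_add {a : E} {r s : RatFunc ℂ} (hr : IsUnit (aeval a r.denom))
    (hs : IsUnit (aeval a s.denom)) : IsUnit (aeval a (r + s).denom) :=
  isUnit_aeval_of_dvd (RatFunc.denom_add_dvd r s) (by rw [map_mul]; exact hr.mul hs)

theorem isUnit_aeval_denom_mul {a : E} {r s : RatFunc ℂ} (hr : IsUnit (aeval a r.denom))
    (hs : IsUnit (aeval a s.denom)) : IsUnit (aeval a (r * s).denom) :=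
  isUnit_aeval_of_dvd (RatFunc.denom_mul_dvd r s) (by rw [map_mul]; exact hr.mul hs)

theorem ratAt_mul {a : E} {r s : RatFunc ℂ} (hr : IsUnit (aeval a r.denom))
    (hs : IsUnit (aeval a s.denom)) : ratAt a (r * s) = ratAt a r * ratAt a s := by
  have hcomm : ∀ S T : ℂ[X], Commute (aeval a S) (aeval a T) := fun S T => by
    rw [commute_iff_eq, ← map_mul, ← map_mul, mul_comm]
  have hrs : IsUnit (aeval a (r.denom * s.denom)) := by rw [map_mul]; exact hr.mul hs
  rw [ratAt_eq_of_mul_eq (isUnit_aeval_denom_mul hr hs) hrs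
    (num_mul_eq_of_eq_div (P := r.num * s.num)
      (mul_ne_zero r.denom_ne_zero s.denom_ne_zero) (by
      rw [map_mul, map_mul, ← div_mul_div_comm, RatFunc.num_div_denom, RatFunc.num_div_denom]))]
  refine hrs.mul_right_cancel ?_
  rw [mul_assoc, Ring.inverse_mul_cancel _ hrs, mul_one, map_mul, map_mul,
    (hcomm r.denom s.denom).eq, ratAt, ratAt, mul_assoc, mul_assoc, mul_assoc (aeval a s.num),
    ← mul_assoc (Ring.inverse (aeval a s.denom)), Ring.inverse_mul_cancel _ hs, one_mul,
    (hcomm s.num r.denom).eq, ← mul_assoc (Ring.inverse _), Ring.inverse_mul_cancel _ hr, one_mul]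

theorem ratAt_add {a : E} {r s : RatFunc ℂ} (hr : IsUnit (aeval a r.denom))
    (hs : IsUnit (aeval a s.denom)) : ratAt a (r + s) = ratAt a r + ratAt a s := by
  have hcomm : ∀ S T : ℂ[X], Commute (aeval a S) (aeval a T) := fun S T => by
    rw [commute_iff_eq, ← map_mul, ← map_mul, mul_comm]
  have hrs : IsUnit (aeval a (r.denom * s.denom)) := by rw [map_mul]; exact hr.mul hs
  have hne : ∀ t : RatFunc ℂ, algebraMap ℂ[X] (RatFunc ℂ) t.denom ≠ 0 := fun t =>
    (map_ne_zero_iff _ (RatFunc.algebraMap_injective ℂ)).2 t.denom_ne_zero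
  rw [ratAt_eq_of_mul_eq (isUnit_aeval_denom_add hr hs) hrs
    (num_mul_eq_of_eq_div (P := r.num * s.denom + r.denom * s.num)
      (mul_ne_zero r.denom_ne_zero s.denom_ne_zero) (by
      rw [map_add, map_mul, map_mul, map_mul, ← div_add_div _ _ (hne r) (hne s),
        RatFunc.num_div_denom, RatFunc.num_div_denom]))]
  refine hrs.mul_right_cancel ?_
  rw [mul_assoc, Ring.inverse_mul_cancel _ hrs, mul_one, map_add, map_mul, map_mul, map_mul,
    add_mul, ratAt, ratAt, mul_assoc, ← mul_assoc (Ring.inverse _), Ring.inverse_mul_cancel _ hr,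
    one_mul, (hcomm r.denom s.denom).eq, mul_assoc, ← mul_assoc (Ring.inverse _),
    Ring.inverse_mul_cancel _ hs, one_mul, (hcomm r.denom s.num).eq]

theorem ratAt_C (a : E) (c : ℂ) : ratAt a (RatFunc.C c) = algebraMap ℂ E c := by
  simp [ratAt]

/-- The rational functions whose reduced denominator is invertible at `a`. On them `ratAt a` is
additive and multiplicative. -/
noncomputable def regularAt (a : E) : Subalgebra ℂ (RatFunc ℂ) where
  carrier := {r | IsUnit (aeval a r.denom)}
  mul_mem' := isUnit_aeval_denom_mul
  add_mem' := isUnit_aeval_denom_add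
  algebraMap_mem' c := by
    simp

theorem mem_regularAt {a : E} {r : RatFunc ℂ} : r ∈ regularAt a ↔ IsUnit (aeval a r.denom) :=
  Iff.rfl

theorem C_mem_regularAt (a : E) (c : ℂ) : RatFunc.C c ∈ regularAt a := by
  simp [mem_regularAt]

theorem ratAt_sum {a : E} {ι : Type*} (s : Finset ι) {r : ι → RatFunc ℂ}
    (hr : ∀ i ∈ s, r i ∈ regularAt a) : ratAt a (∑ i ∈ s, r i) = ∑ i ∈ s, ratAt a (r i) := by
  classical
  induction s using Finset.induction_on with
  | empty => simp [ratAt]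
  | insert i s hi ih =>
    rw [sum_insert hi, sum_insert hi, ratAt_add (hr i (mem_insert_self i s))
      (sum_mem (S := regularAt a) fun j hj => hr j (mem_insert_of_mem hj)),
      ih fun j hj => hr j (mem_insert_of_mem hj)]

theorem map_ratAt_mul {a : E} {l m n : ℕ} {M : Matrix (Fin l) (Fin m) (RatFunc ℂ)}
    {N : Matrix (Fin m) (Fin n) (RatFunc ℂ)} (hM : ∀ i j, M i j ∈ regularAt a)
    (hN : ∀ i j, N i j ∈ regularAt a) :
    (M * N).map (ratAt a) = M.map (ratAt a) * N.map (ratAt a) := by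
  ext i j : 2
  rw [Matrix.map_apply, Matrix.mul_apply, Matrix.mul_apply,
    ratAt_sum _ fun k _ => mul_mem (hM i k) (hN k j)]
  exact sum_congr rfl fun k _ => ratAt_mul (hM i k) (hN k j)

theorem mul_mem_regularAt {a : E} {l m n : ℕ} {M : Matrix (Fin l) (Fin m) (RatFunc ℂ)}
    {N : Matrix (Fin m) (Fin n) (RatFunc ℂ)} (hM : ∀ i j, M i j ∈ regularAt a)
    (hN : ∀ i j, N i j ∈ regularAt a) (i : Fin l) (j : Fin n) : (M * N) i j ∈ regularAt a := by
  rw [Matrix.mul_apply]; exact sum_mem fun k _ => mul_mem (hM i k) (hN k j)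

/-- The rational function `1 / (σ - z)` of `z`. -/
noncomputable def simplePole (σ : ℂ) : RatFunc ℂ :=
  algebraMap ℂ[X] (RatFunc ℂ) 1 / algebraMap ℂ[X] (RatFunc ℂ) (C σ - X)

theorem C_sub_X_ne_zero (σ : ℂ) : (C σ - X : ℂ[X]) ≠ 0 := by
  rw [← neg_sub, neg_ne_zero]; exact X_sub_C_ne_zero σ

theorem simplePole_mem {a : E} {σ : ℂ} (h : IsUnit (algebraMap ℂ E σ - a)) :
    simplePole σ ∈ regularAt a :=
  isUnit_aeval_of_dvd (RatFunc.denom_div_dvd 1 (C σ - X)) (by simpa using h)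

theorem ratAt_simplePole {a : E} {σ : ℂ} (h : IsUnit (algebraMap ℂ E σ - a)) :
    ratAt a (simplePole σ) = Ring.inverse (algebraMap ℂ E σ - a) := by
  rw [ratAt_eq_of_mul_eq (P := 1) (Q := C σ - X) (simplePole_mem h) (by simpa using h)
    (num_mul_eq_of_eq_div (C_sub_X_ne_zero σ) rfl)]
  simp

theorem ratAt_C_mul {a : E} {r : RatFunc ℂ} (hr : r ∈ regularAt a) (c : ℂ) :
    ratAt a (RatFunc.C c * r) = c • ratAt a r := by
  rw [ratAt_mul (C_mem_regularAt a c) hr, ratAt_C, Algebra.smul_def]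

theorem map_ratAt_C_mul {a : E} {m n : ℕ} {R : Matrix (Fin m) (Fin n) (RatFunc ℂ)}
    (hR : ∀ i j, R i j ∈ regularAt a) (c : ℂ) :
    (R.map fun r => RatFunc.C c * r).map (ratAt a) = c • R.map (ratAt a) := by
  ext i j
  exact ratAt_C_mul (hR i j) c

theorem ratEval_eq_ratAt (r : RatFunc ℂ) (z : ℂ) : ratEval r z = ratAt z r := by
  simp [ratEval, RatFunc.eval, ratAt, aeval_def, div_eq_mul_inv, eval₂_eq_eval_map]

theorem noPoleOn_iff {r : RatFunc ℂ} {Ω : Set ℂ} : NoPoleOn r Ω ↔ ∀ z ∈ Ω, r ∈ regularAt z := by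
  simp [NoPoleOn, mem_regularAt, coe_aeval_eq_eval]

theorem isUnit_aeval_of_spectrum {E : Type*} [NormedRing E] [NormedAlgebra ℂ E] [CompleteSpace E]
    {a : E} {Q : ℂ[X]} (hQ : Q ≠ 0) (h : ∀ z ∈ spectrum ℂ a, Q.eval z ≠ 0) :
    IsUnit (aeval a Q) := by
  by_cases hd : 0 < Q.degree
  · by_contra hu
    have h0 : (0 : ℂ) ∈ spectrum ℂ (aeval a Q) := by rwa [spectrum.zero_mem_iff]
    rw [spectrum.map_polynomial_aeval_of_degree_pos a Q hd] at h0
    obtain ⟨z, hz, hz0⟩ := h0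
    exact h z hz hz0
  · rw [eq_C_of_degree_le_zero (not_lt.1 hd)] at hQ ⊢
    rw [aeval_C]
    exact (IsUnit.mk0 _ (by simpa using hQ)).map (algebraMap ℂ E)

end RationalCalculus

section NumericalRange

variable {H : Type u} [NormedAddCommGroup H] [InnerProductSpace ℂ H]

theorem exists_mem_numericalRange_smul (A : H →L[ℂ] H) {x : H} (hx : x ≠ 0) :
    ∃ v ∈ numericalRange A, inner ℂ x (A x) = (‖x‖ ^ 2 : ℝ) * v := by
  have hn : (‖x‖ : ℂ) ≠ 0 := by exact_mod_cast (norm_pos_iff.2 hx).ne'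
  refine ⟨_, ⟨((‖x‖⁻¹ : ℝ) : ℂ) • x, ?_, rfl⟩, ?_⟩
  · rw [norm_smul, Complex.norm_real, norm_inv, norm_norm, inv_mul_cancel₀ (norm_pos_iff.2 hx).ne']
  · rw [map_smul, inner_smul_left, inner_smul_right, Complex.conj_ofReal]
    push_cast; field_simp

theorem isBounded_numericalRange (A : H →L[ℂ] H) : Bornology.IsBounded (numericalRange A) := by
  refine isBounded_iff_forall_norm_le.2 ⟨‖A‖, ?_⟩
  rintro _ ⟨x, hx, rfl⟩
  refine (norm_inner_le_norm _ _).trans ?_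
  have := A.le_opNorm x
  rw [hx] at *
  linarith

variable [CompleteSpace H]

/-- All operators `w + s (A - w)` with `0 ≤ s ≤ 1` have their numerical range in the convex set
`C`, so their distance from the scalar `z` is bounded below in the sense of quadratic forms. -/
theorem isUnit_sub_of_notMem {A : H →L[ℂ] H} {C : Set ℂ} (hCc : IsClosed C) (hC : Convex ℝ C)
    (hA : numericalRange A ⊆ C) {w z : ℂ} (hw : w ∈ C) (hz : z ∉ C) {s : ℝ}
    (hs : s ∈ Set.Icc (0 : ℝ) 1) :
    IsUnit (algebraMap ℂ (H →L[ℂ] H) (z - w) - (s : ℂ) • (A - algebraMap ℂ (H →L[ℂ] H) w)) := by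
  have hd : 0 < Metric.infDist z C := (hCc.notMem_iff_infDist_pos ⟨w, hw⟩).1 hz
  refine ContinuousLinearMap.isUnit_of_forall_le_norm_inner_map _
    (c := ⟨Metric.infDist z C, hd.le⟩) hd fun x => ?_
  by_cases hx : x = 0
  · simp [hx]
  obtain ⟨v, hv, hvx⟩ := exists_mem_numericalRange_smul A hx
  have h1 : inner ℂ x ((algebraMap ℂ (H →L[ℂ] H) (z - w)
      - (s : ℂ) • (A - algebraMap ℂ (H →L[ℂ] H) w)) x)
      = (‖x‖ ^ 2 : ℝ) * (z - ((1 - s) • w + s • v)) := by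
    simp only [Algebra.algebraMap_eq_smul_one, sub_apply, smul_apply, one_apply_eq_self,
      inner_sub_right, inner_smul_right, hvx, inner_self_eq_norm_sq_to_K, Complex.real_smul]
    push_cast
    ring
  rw [← inner_conj_symm, RCLike.norm_conj, h1, norm_mul, Complex.norm_real,
    Real.norm_of_nonneg (by positivity)]
  refine mul_le_mul_of_nonneg_left ?_ (by positivity)
  rw [← dist_eq_norm]
  exact Metric.infDist_le_dist_of_mem (hC hw (hA hv) (by linarith [hs.2]) hs.1 (by ring))

theorem spectrum_subset_of_numericalRange_subset {A : H →L[ℂ] H} {C : Set ℂ} (hCc : IsClosed C)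
    (hC : Convex ℝ C) (hCne : C.Nonempty) (hA : numericalRange A ⊆ C) : spectrum ℂ A ⊆ C := by
  intro z hz
  by_contra hzC
  obtain ⟨w, hw⟩ := hCne
  have := isUnit_sub_of_notMem hCc hC hA hw hzC (s := 1) ⟨zero_le_one, le_rfl⟩
  refine hz ?_
  rw [spectrum.mem_resolventSet_iff]
  simpa using this

/-- Positivity of the kernel `2 Re (c (σ - A)⁻¹)` when the numerical range of `A` lies in the half
plane where `Re (c / (σ - v)) ≥ 0`. -/
theorem smul_resolvent_add_star_nonneg {A : H →L[ℂ] H} {σ c : ℂ}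
    (hu : IsUnit (algebraMap ℂ (H →L[ℂ] H) σ - A))
    (h : ∀ v ∈ numericalRange A, 0 ≤ (c * (starRingEnd ℂ) (σ - v)).re) :
    0 ≤ c • Ring.inverse (algebraMap ℂ (H →L[ℂ] H) σ - A)
      + star (c • Ring.inverse (algebraMap ℂ (H →L[ℂ] H) σ - A)) := by
  set B := Ring.inverse (algebraMap ℂ (H →L[ℂ] H) σ - A)
  rw [ContinuousLinearMap.nonneg_iff_isPositive]
  refine ContinuousLinearMap.isPositive_def'.2 ⟨?_, fun x => ?_⟩
  · exact IsSelfAdjoint.add_star_self _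
  · have hx : x = (algebraMap ℂ (H →L[ℂ] H) σ - A) (B x) := by
      rw [← mul_apply_eq_comp, Ring.mul_inverse_cancel _ hu]; rfl
    have h1 : (c • B + star (c • B)).reApplyInnerSelf x = 2 * (inner ℂ ((c • B) x) x).re := by
      rw [ContinuousLinearMap.reApplyInnerSelf_apply, add_apply, inner_add_left,
        ContinuousLinearMap.star_eq_adjoint, ContinuousLinearMap.adjoint_inner_left,
        ← inner_conj_symm x, RCLike.re_to_complex, Complex.add_re, Complex.conj_re]
      ring
    rw [h1]
    refine mul_nonneg zero_le_two ?_
    by_cases hy : B x = 0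
    · simp [hy]
    obtain ⟨v, hv, hvx⟩ := exists_mem_numericalRange_smul A hy
    have h2 : inner ℂ ((c • B) x) x
        = (‖B x‖ ^ 2 : ℝ) * (starRingEnd ℂ) (c * (starRingEnd ℂ) (σ - v)) := by
      have h3 : inner ℂ (B x) ((algebraMap ℂ (H →L[ℂ] H) σ - A) (B x))
          = (‖B x‖ ^ 2 : ℝ) * (σ - v) := by
        rw [Algebra.algebraMap_eq_smul_one, sub_apply, smul_apply, one_apply_eq_self,
          inner_sub_right, inner_smul_right, hvx, inner_self_eq_norm_sq_to_K]
        push_cast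
        simp only [Complex.coe_algebraMap]
        ring
      rw [← hx] at h3
      rw [smul_apply, inner_smul_left, h3, map_mul, Complex.conj_conj]
      ring
    rw [h2, Complex.re_ofReal_mul, Complex.conj_re]
    exact mul_nonneg (by positivity) (h v hv)

end NumericalRange

/-! ### The Cauchy formula for rational functions -/

section Approximation

theorem l2_opNorm_eq_norm_matrixOp {m n : ℕ} (X : Matrix (Fin m) (Fin n) ℂ) :
    ‖X‖ = ‖matrixOp (X.map (algebraMap ℂ (ℂ →L[ℂ] ℂ)))‖ := by
  rw [Matrix.l2_opNorm_def]
  congr 1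
  ext x i
  simp [matrixOp_apply, Matrix.toLpLin_apply, Matrix.mulVec, dotProduct,
    Algebra.algebraMap_eq_smul_one]

theorem norm_entry_le_l2_opNorm {m n : ℕ} (X : Matrix (Fin m) (Fin n) ℂ) (i : Fin m) (j : Fin n) :
    ‖X i j‖ ≤ ‖X‖ := by
  rw [l2_opNorm_eq_norm_matrixOp]
  refine le_trans (le_of_eq ?_) (norm_entry_le_norm_matrixOp _ i j)
  simp [Algebra.algebraMap_eq_smul_one, norm_smul]

theorem l2_opNorm_le_sum {m n : ℕ} (X : Matrix (Fin m) (Fin n) ℂ) :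
    ‖X‖ ≤ ∑ i, ∑ j, ‖X i j‖ := by
  rw [l2_opNorm_eq_norm_matrixOp]
  refine (norm_matrixOp_le_sum _).trans (le_of_eq ?_)
  simp [Algebra.algebraMap_eq_smul_one, norm_smul]

theorem exists_convex_neighborhoods {C O : Set ℂ} (hC : IsCompact C) (hCc : Convex ℝ C)
    (hO : IsOpen O) (hCO : C ⊆ O) : ∃ V U : Set ℂ, IsOpen V ∧ Convex ℝ V ∧ Bornology.IsBounded V ∧
      C ⊆ V ∧ Convex ℝ U ∧ closure V ⊆ U ∧ U ⊆ O := by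
  obtain ⟨δ, hδ, h⟩ := hC.exists_thickening_subset_open hO hCO
  refine ⟨Metric.thickening (δ / 2) C, Metric.thickening δ C, Metric.isOpen_thickening,
    hCc.thickening _, hC.isBounded.thickening, Metric.self_subset_thickening (by linarith) C,
    hCc.thickening _, ?_, h⟩
  exact (Metric.closure_thickening_subset_cthickening _ _).trans
    (Metric.cthickening_subset_thickening' hδ (by linarith) C)

open scoped Pointwise in
/-- A compact subset of an open convex set has a compact convex neighbourhood there: the convex
hull of a finite net, thickened by the mesh of the net. -/
theorem exists_compact_convex_superset {K Ω : Set ℂ} (hK : IsCompact K) (hΩo : IsOpen Ω)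
    (hΩ : Convex ℝ Ω) (hKΩ : K ⊆ Ω) : ∃ C, IsCompact C ∧ Convex ℝ C ∧ K ⊆ C ∧ C ⊆ Ω := by
  obtain ⟨δ, hδ, hδΩ⟩ := hK.exists_cthickening_subset_open hΩo hKΩ
  obtain ⟨t, htK, htf, hcov⟩ := hK.finite_cover_balls hδ
  refine ⟨convexHull ℝ t + Metric.closedBall 0 δ,
    (Set.Finite.isCompact_convexHull (𝕜 := ℝ) htf).add (isCompact_closedBall _ _),
    (convex_convexHull _ _).add (convex_closedBall _ _), fun z hz => ?_, ?_⟩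
  · obtain ⟨x, hx, hzx⟩ := Set.mem_iUnion₂.1 (hcov hz)
    refine ⟨x, subset_convexHull _ _ hx, z - x, ?_, by simp⟩
    simpa [dist_eq_norm] using (Metric.mem_ball.1 hzx).le
  · rintro _ ⟨q, hq, v, hv, rfl⟩
    refine convexHull_min (t := (fun q => q + v) ⁻¹' Ω) (fun x hx => hδΩ ?_)
      (hΩ.translate_preimage_left v) hq
    exact Metric.mem_cthickening_of_dist_le _ x δ _ (htK hx) (by simpa using hv)

variable {V U : Set ℂ} {w : ℂ} {p : ℕ → ℕ → ℂ}

/-- The weights `Δσ / (2πi)` of the Riemann sums of the Cauchy integral. -/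
noncomputable def cauchyWeight (p : ℕ → ℕ → ℂ) (N j : ℕ) : ℂ :=
  (p N (j + 1) - p N j) / (2 * Real.pi * Complex.I)

theorem BoundarySampling.tendsto_sum_ratAt {E : Type*} [NormedRing E] [NormedAlgebra ℂ E]
    [CompleteSpace E] (hp : BoundarySampling V w p) (hVc : Convex ℝ V)
    (hVb : Bornology.IsBounded V) (hUc : Convex ℝ U) (hVU : closure V ⊆ U) {a : E}
    (ha : ∀ z ∈ frontier V, ∀ s ∈ Set.Icc (0 : ℝ) 1,
      IsUnit (algebraMap ℂ E (z - w) - (s : ℂ) • (a - algebraMap ℂ E w)))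
    {r : RatFunc ℂ} (hr : NoPoleOn r U) (hra : r ∈ regularAt a) :
    Tendsto (fun N => ∑ j ∈ range N, ratEval r (p N j) • cauchyWeight p N j •
      Ring.inverse (algebraMap ℂ E (p N j) - a)) atTop (𝓝 (ratAt a r)) := by
  have h := (hp.tendsto_sum_cauchy hVc hVb hUc hVU ha (P := r.num) hr hra).const_smul
    (2 * Real.pi * Complex.I : ℂ)⁻¹
  have hpi : (2 * Real.pi * Complex.I : ℂ) ≠ 0 := Complex.two_pi_I_ne_zero
  rw [smul_smul, inv_mul_cancel₀ hpi, one_smul] at h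
  refine h.congr fun N => ?_
  rw [smul_sum]
  refine sum_congr rfl fun j _ => ?_
  rw [smul_smul, smul_smul]
  congr 1
  rw [ratEval_eq_ratAt, ratAt, Ring.inverse_eq_inv', cauchyWeight, Polynomial.coe_aeval_eq_eval]
  field_simp

theorem BoundarySampling.tendsto_sum_one {E : Type*} [NormedRing E] [NormedAlgebra ℂ E]
    [CompleteSpace E] (hp : BoundarySampling V w p) (hVb : Bornology.IsBounded V) {a : E}
    (ha : ∀ z ∈ frontier V, ∀ s ∈ Set.Icc (0 : ℝ) 1,
      IsUnit (algebraMap ℂ E (z - w) - (s : ℂ) • (a - algebraMap ℂ E w))) :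
    Tendsto (fun N => ∑ j ∈ range N, cauchyWeight p N j •
      Ring.inverse (algebraMap ℂ E (p N j) - a)) atTop (𝓝 1) := by
  have h := (hp.tendsto_sum_resolvent hVb ha).const_smul (2 * Real.pi * Complex.I : ℂ)⁻¹
  rw [smul_smul, inv_mul_cancel₀ Complex.two_pi_I_ne_zero, one_smul] at h
  refine h.congr fun N => ?_
  rw [smul_sum]
  refine sum_congr rfl fun j _ => ?_
  rw [smul_smul, cauchyWeight, div_eq_inv_mul]

theorem BoundarySampling.isUnit_sub {E : Type*} [NormedRing E] [NormedAlgebra ℂ E]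
    (hp : BoundarySampling V w p) {a : E}
    (ha : ∀ z ∈ frontier V, ∀ s ∈ Set.Icc (0 : ℝ) 1,
      IsUnit (algebraMap ℂ E (z - w) - (s : ℂ) • (a - algebraMap ℂ E w))) (N j : ℕ) :
    IsUnit (algebraMap ℂ E (p N j) - a) := by
  simpa using ha _ (hp.mem_frontier N j) 1 ⟨zero_le_one, le_rfl⟩

theorem ratAt_algHom {E F : Type*} [Ring E] [Algebra ℂ E] [Ring F] [Algebra ℂ F] (ψ : E →ₐ[ℂ] F)
    {a : E} {r : RatFunc ℂ} (hr : r ∈ regularAt a) : ψ (ratAt a r) = ratAt (ψ a) r := by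
  have h1 : ∀ Q : Polynomial ℂ, Polynomial.aeval (ψ a) Q = ψ (Polynomial.aeval a Q) :=
    fun Q => Polynomial.aeval_algHom_apply ψ a Q
  obtain ⟨v, hv⟩ := mem_regularAt.1 hr
  rw [ratAt, ratAt, h1, h1, ← hv, map_mul, Ring.inverse_unit]
  congr 1
  have : ψ (v : E) = (Units.map (ψ : E →* F) v : F) := rfl
  rw [this, Ring.inverse_unit]
  rfl

theorem notMem_of_mem_frontier {V : Set ℂ} (hV : IsOpen V) {z : ℂ} (hz : z ∈ frontier V) :
    z ∉ V := fun h => by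
  have := hz.2; rw [hV.interior_eq] at this; exact this h

/-- The Riemann sums converge to `r` uniformly on compact subsets of `V`. This is
`tendsto_sum_ratAt` in the Banach algebra of continuous functions on the compact set, at the
coordinate function. -/
theorem BoundarySampling.eventually_uniform (hp : BoundarySampling V w p) (hV : IsOpen V)
    (hVc : Convex ℝ V)
    (hVb : Bornology.IsBounded V) (hUc : Convex ℝ U) (hVU : closure V ⊆ U) {C : Set ℂ}
    (hC : IsCompact C) (hCV : C ⊆ V) (hw : w ∈ V)
    {r : RatFunc ℂ} (hr : NoPoleOn r U) {ε : ℝ} (hε : 0 < ε) :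
    ∀ᶠ N in atTop, ∀ z ∈ C, ‖ratEval r z - ∑ j ∈ range N, ratEval r (p N j) *
      (cauchyWeight p N j * (p N j - z)⁻¹)‖ ≤ ε := by
  have : CompactSpace C := isCompact_iff_compactSpace.1 hC
  let a : C(C, ℂ) := ⟨Subtype.val, continuous_subtype_val⟩
  let ev : C → C(C, ℂ) →ₐ[ℂ] ℂ := fun z => ContinuousMap.evalAlgHom ℂ ℂ z
  have ha : ∀ z ∈ frontier V, ∀ s ∈ Set.Icc (0 : ℝ) 1,
      IsUnit (algebraMap ℂ C(C, ℂ) (z - w) - (s : ℂ) • (a - algebraMap ℂ C(C, ℂ) w)) := by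
    intro z hz s hs
    rw [ContinuousMap.isUnit_iff_forall_ne_zero]
    intro x h0
    refine notMem_of_mem_frontier hV hz ?_
    have h1 : z = (1 - s) • w + s • (x : ℂ) := by
      simp [a] at h0
      simp only [Complex.real_smul]
      push_cast
      linear_combination h0
    rw [h1]
    exact hVc hw (hCV x.2) (by linarith [hs.2]) hs.1 (by ring)
  have hra : r ∈ regularAt a := by
    rw [mem_regularAt, ContinuousMap.isUnit_iff_forall_ne_zero]
    intro x
    have : (Polynomial.aeval a r.denom) x = r.denom.eval (x : ℂ) := by
      have := Polynomial.aeval_algHom_apply (ev x) a r.denom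
      rw [Polynomial.coe_aeval_eq_eval] at this
      exact this.symm
    rw [this]
    exact hr x (hVU (subset_closure (hCV x.2)))
  have h := hp.tendsto_sum_ratAt hVc hVb hUc hVU ha hr hra
  filter_upwards [(Metric.tendsto_nhds.1 h) ε hε] with N hN z hz
  rw [dist_eq_norm, norm_sub_rev] at hN
  refine le_trans (le_of_eq ?_) ((ContinuousMap.norm_coe_le_norm _ ⟨z, hz⟩).trans hN.le)
  congr 1
  have hev : ∀ f : C(C, ℂ), f ⟨z, hz⟩ = ev ⟨z, hz⟩ f := fun _ => rfl
  rw [hev, map_sub, ratAt_algHom _ hra, map_sum, ratEval_eq_ratAt]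
  congr 1
  refine sum_congr rfl fun j _ => ?_
  rw [map_smul, map_smul, smul_eq_mul, smul_eq_mul]
  congr 2
  have hu := hp.isUnit_sub ha N j
  have h1 := congrArg (ev ⟨z, hz⟩) (Ring.mul_inverse_cancel _ hu)
  rw [map_mul, map_one, map_sub, AlgHom.commutes] at h1
  exact (eq_inv_of_mul_eq_one_right h1).symm

end Approximation

section APriori

variable {H : Type u} [NormedAddCommGroup H] [InnerProductSpace ℂ H] [CompleteSpace H]

omit [CompleteSpace H] in
theorem exists_compact_convex_between {Ω : Set ℂ} (hΩo : IsOpen Ω) (hΩ : Convex ℝ Ω)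
    (hne : Ω.Nonempty) {A : H →L[ℂ] H} (hA : closure (numericalRange A) ⊆ Ω) :
    ∃ C : Set ℂ, IsCompact C ∧ Convex ℝ C ∧ C.Nonempty ∧ C ⊆ Ω ∧ numericalRange A ⊆ C := by
  obtain ⟨w, hw⟩ := hne
  obtain ⟨C, hC, hCc, hKC, hCΩ⟩ := exists_compact_convex_superset
    ((isBounded_numericalRange A).isCompact_closure.insert w) hΩo hΩ (Set.insert_subset hw hA)
  exact ⟨C, hC, hCc, ⟨w, hKC (Set.mem_insert _ _)⟩, hCΩ,
    subset_closure.trans ((Set.subset_insert _ _).trans hKC)⟩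

theorem mem_regularAt_of_noPoleOn {Ω : Set ℂ} (hΩo : IsOpen Ω) (hΩ : Convex ℝ Ω) (hne : Ω.Nonempty)
    {A : H →L[ℂ] H} (hA : closure (numericalRange A) ⊆ Ω) {r : RatFunc ℂ} (hr : NoPoleOn r Ω) :
    r ∈ regularAt A := by
  obtain ⟨C, hC, hCc, hCne, hCΩ, hAC⟩ := exists_compact_convex_between hΩo hΩ hne hA
  exact isUnit_aeval_of_spectrum r.denom_ne_zero fun z hz =>
    hr z (hCΩ (spectrum_subset_of_numericalRange_subset hC.isClosed hCc hCne hAC hz))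

/-- The a priori bound: by Cauchy's formula on a curve inside `Ω`, the norm of `r(A)` is at most a
multiple of the supremum of `r` over `Ω`. -/
theorem exists_norm_ratOp_le {Ω : Set ℂ} (hΩo : IsOpen Ω) (hΩ : Convex ℝ Ω) (hne : Ω.Nonempty)
    {A : H →L[ℂ] H} (hA : closure (numericalRange A) ⊆ Ω) :
    ∃ B : ℝ, ∀ r : RatFunc ℂ, NoPoleOn r Ω → (∀ z ∈ Ω, ‖ratEval r z‖ ≤ 1) → ‖ratOp r A‖ ≤ B := by
  obtain ⟨C, hC, hCc, ⟨w, hw⟩, hCΩ, hAC⟩ := exists_compact_convex_between hΩo hΩ hne hA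
  obtain ⟨V, U, hV, hVc, hVb, hCV, hUc, hVU, hUΩ⟩ := exists_convex_neighborhoods hC hCc hΩo hCΩ
  obtain ⟨p, hp⟩ := exists_boundarySampling hV hVc hVb (hCV hw)
  have ha : ∀ z ∈ frontier V, ∀ s ∈ Set.Icc (0 : ℝ) 1, IsUnit (algebraMap ℂ (H →L[ℂ] H) (z - w)
      - (s : ℂ) • (A - algebraMap ℂ (H →L[ℂ] H) w)) := fun z hz s hs =>
    isUnit_sub_of_notMem hC.isClosed hCc hAC hw
      (fun h => notMem_of_mem_frontier hV hz (hCV h)) hs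
  obtain ⟨L, hL⟩ := hp.sum_norm_step_le
  obtain ⟨M, hM⟩ := exists_norm_ringInverse_le
    (hVb.isCompact_closure.of_isClosed_subset isClosed_frontier frontier_subset_closure)
    (f := fun z : ℂ => algebraMap ℂ (H →L[ℂ] H) z - A)
    ((algebraMapCLM ℂ (H →L[ℂ] H)).continuous.sub continuous_const)
    (fun z hz => by simpa using ha z hz 1 ⟨zero_le_one, le_rfl⟩)
  have hM0 : 0 ≤ M := (norm_nonneg _).trans (hM _ (hp.mem_frontier 0 0))
  refine ⟨L * ‖(2 * Real.pi * Complex.I : ℂ)⁻¹‖ * M, fun r hr hr1 => ?_⟩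
  have h := hp.tendsto_sum_ratAt hVc hVb hUc hVU ha (fun z hz => hr z (hUΩ hz))
    (mem_regularAt_of_noPoleOn hΩo hΩ hne hA hr)
  refine le_of_tendsto h.norm ?_
  filter_upwards [eventually_gt_atTop 0] with N hN
  have hterm : ∀ j ∈ range N, ‖ratEval r (p N j) • cauchyWeight p N j •
      Ring.inverse (algebraMap ℂ (H →L[ℂ] H) (p N j) - A)‖
      ≤ ‖p N (j + 1) - p N j‖ * (‖(2 * Real.pi * Complex.I : ℂ)⁻¹‖ * M) := by
    intro j _
    have hpΩ : p N j ∈ Ω := hUΩ (hVU (frontier_subset_closure (hp.mem_frontier N j)))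
    rw [norm_smul, norm_smul, cauchyWeight, div_eq_mul_inv, norm_mul, mul_assoc]
    refine (mul_le_of_le_one_left (by positivity) (hr1 _ hpΩ)).trans ?_
    exact mul_le_mul_of_nonneg_left (mul_le_mul_of_nonneg_left (hM _ (hp.mem_frontier N j))
      (norm_nonneg _)) (norm_nonneg _)
  refine (norm_sum_le_of_le _ hterm).trans ?_
  rw [← sum_mul, mul_assoc L]
  exact mul_le_mul_of_nonneg_right (hL N hN) (by positivity)

end APriori

/-! ### The conjugate Cauchy transform -/

section BoundedMatrices

/-- The matrix valued rational function `R` has no poles on `Ω` and is bounded by `b` there. -/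
structure BoundedOn {m n : ℕ} (Ω : Set ℂ) (R : Matrix (Fin m) (Fin n) (RatFunc ℂ)) (b : ℝ) :
    Prop where
  noPole : ∀ i j, NoPoleOn (R i j) Ω
  norm_le : ∀ z ∈ Ω, ‖R.map (ratAt z)‖ ≤ b

variable {m n : ℕ} {Ω : Set ℂ} {R : Matrix (Fin m) (Fin n) (RatFunc ℂ)} {b : ℝ}

theorem BoundedOn.norm_entry_le (hR : BoundedOn Ω R b) {z : ℂ} (hz : z ∈ Ω) (i : Fin m)
    (j : Fin n) : ‖ratEval (R i j) z‖ ≤ b := by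
  rw [ratEval_eq_ratAt]
  exact (norm_entry_le_l2_opNorm (R.map (ratAt z)) i j).trans (hR.norm_le z hz)

/-- A rational function that is bounded on a set has no pole on the closure. -/
theorem noPoleOn_closure {r : RatFunc ℂ} (hr : NoPoleOn r Ω) (hb : ∀ z ∈ Ω, ‖ratEval r z‖ ≤ b) :
    NoPoleOn r (closure Ω) := by
  intro z hz h0
  have hle : ∀ x ∈ Ω, ‖r.num.eval x‖ ≤ b * ‖r.denom.eval x‖ := by
    intro x hx
    have := hb x hx
    rwa [ratEval_eq_ratAt, ratAt, Ring.inverse_eq_inv', Polynomial.coe_aeval_eq_eval, norm_mul,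
      norm_inv, ← div_eq_mul_inv, div_le_iff₀ (norm_pos_iff.2 (hr x hx))] at this
  have h1 := le_on_closure hle r.num.continuous.norm.continuousOn
    (continuous_const.mul r.denom.continuous.norm).continuousOn hz
  rw [h0, norm_zero, mul_zero] at h1
  obtain ⟨s, t, hst⟩ := r.isCoprime_num_denom
  have h2 := congrArg (Polynomial.eval z) hst
  rw [Polynomial.eval_add, Polynomial.eval_mul, Polynomial.eval_mul, h0,
    norm_le_zero_iff.1 h1] at h2
  simp at h2

theorem continuousOn_map_ratAt {D : Set ℂ} (hR : ∀ i j, NoPoleOn (R i j) D) :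
    ContinuousOn (fun z => R.map (ratAt z)) D := by
  refine continuousOn_pi.2 fun i => continuousOn_pi.2 fun j => ?_
  have : (fun z : ℂ => R.map (ratAt z) i j)
      = fun z => (R i j).num.eval z / (R i j).denom.eval z := by
    funext z
    rw [Matrix.map_apply, ratAt, Ring.inverse_eq_inv', Polynomial.coe_aeval_eq_eval, div_eq_mul_inv]
  rw [this]
  exact (R i j).num.continuous.continuousOn.div (R i j).denom.continuous.continuousOn (hR i j)

theorem BoundedOn.exists_open (hR : BoundedOn Ω R b) {b' : ℝ} (hb : b < b') :
    ∃ O : Set ℂ, IsOpen O ∧ closure Ω ⊆ O ∧ BoundedOn O R b' := by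
  set D : Set ℂ := {z | ∀ i j, (R i j).denom.eval z ≠ 0} with hD
  have hDo : IsOpen D := by
    have : D = ⋂ i, ⋂ j, {z | (R i j).denom.eval z ≠ 0} := by
      ext z; simp [hD]
    rw [this]
    exact isOpen_iInter_of_finite fun i => isOpen_iInter_of_finite fun j =>
      isOpen_ne_fun (R i j).denom.continuous continuous_const
  have hcl : closure Ω ⊆ D := fun z hz i j =>
    noPoleOn_closure (hR.noPole i j) (fun x hx => hR.norm_entry_le hx i j) z hz
  have hcont : ContinuousOn (fun z => R.map (ratAt z)) D :=
    continuousOn_map_ratAt fun i j z hz => hz i j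
  refine ⟨D ∩ (fun z => R.map (ratAt z)) ⁻¹' {X | ‖X‖ < b'},
    hcont.isOpen_inter_preimage hDo (isOpen_lt continuous_norm continuous_const),
    fun z hz => ⟨hcl hz, ?_⟩, fun i j z hz => hz.1 i j, fun z hz => le_of_lt hz.2⟩
  exact (le_on_closure (f := fun z => ‖R.map (ratAt z)‖) (g := fun _ => b) hR.norm_le
    (hcont.mono hcl).norm continuousOn_const hz).trans_lt hb

end BoundedMatrices

section Main

variable {H : Type u} [NormedAddCommGroup H] [InnerProductSpace ℂ H] [CompleteSpace H]
variable {m n : ℕ}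

/-- The rational function `∑ₖ Xₖᴴ cₖ / (σₖ - z)` of `z`. With `Xₖ = R(σₖ)` it is a Riemann sum of
the Cauchy transform of `Rᴴ`. -/
noncomputable def cauchyConj (N : ℕ) (c σ : ℕ → ℂ) (X : ℕ → Matrix (Fin m) (Fin n) ℂ) :
    Matrix (Fin n) (Fin m) (RatFunc ℂ) :=
  fun j i => ∑ k ∈ range N, RatFunc.C ((starRingEnd ℂ) (X k i j) * c k) * simplePole (σ k)

section

variable {E : Type*} [Ring E] [Algebra ℂ E] {a : E} {N : ℕ} {c σ : ℕ → ℂ}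
  {X : ℕ → Matrix (Fin m) (Fin n) ℂ}

theorem cauchyConj_mem (hu : ∀ k, IsUnit (algebraMap ℂ E (σ k) - a)) (j : Fin n) (i : Fin m) :
    cauchyConj N c σ X j i ∈ regularAt a :=
  sum_mem fun k _ => mul_mem (C_mem_regularAt a _) (simplePole_mem (hu k))

theorem ratAt_cauchyConj (hu : ∀ k, IsUnit (algebraMap ℂ E (σ k) - a)) (j : Fin n) (i : Fin m) :
    ratAt a (cauchyConj N c σ X j i) = ∑ k ∈ range N,
      (starRingEnd ℂ) (X k i j) • c k • Ring.inverse (algebraMap ℂ E (σ k) - a) := by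
  rw [cauchyConj, ratAt_sum _ fun k _ => mul_mem (C_mem_regularAt a _) (simplePole_mem (hu k))]
  refine sum_congr rfl fun k _ => ?_
  rw [ratAt_C_mul (simplePole_mem (hu k)), ratAt_simplePole (hu k), mul_smul]

end

/-- The estimate of `R(A) + G(A)⋆` in terms of the quadrature error `ε`: apart from the errors it
is `∑ₖ X(σₖ) ⊗ Pₖ` with positive operators `Pₖ = 2 Re (cₖ (σₖ - A)⁻¹)` whose sum is close to `2`.
-/
theorem norm_add_cauchyConj_op_le {A : H →L[ℂ] H} {N : ℕ} {c σ : ℕ → ℂ}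
    {X : ℕ → Matrix (Fin m) (Fin n) ℂ} {β ε : ℝ} (hβ : 0 ≤ β) (hX : ∀ k, ‖X k‖ ≤ β)
    (hu : ∀ k, IsUnit (algebraMap ℂ (H →L[ℂ] H) (σ k) - A))
    (hpos : ∀ k, ∀ v ∈ numericalRange A, 0 ≤ (c k * (starRingEnd ℂ) (σ k - v)).re)
    (hone : ‖∑ k ∈ range N, c k • Ring.inverse (algebraMap ℂ (H →L[ℂ] H) (σ k) - A) - 1‖ ≤ ε)
    {T : Matrix (Fin m) (Fin n) (H →L[ℂ] H)}
    (hT : ∀ i j, ‖T i j - ∑ k ∈ range N, X k i j • c k •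
      Ring.inverse (algebraMap ℂ (H →L[ℂ] H) (σ k) - A)‖ ≤ ε) :
    ‖matrixOp T + ContinuousLinearMap.adjoint (matrixOp ((cauchyConj N c σ X).map (ratAt A)))‖
      ≤ m * n * ε + β * (2 * (1 + ε)) := by
  set B : ℕ → H →L[ℂ] H := fun k => c k • Ring.inverse (algebraMap ℂ (H →L[ℂ] H) (σ k) - A)
  have hdec : T + ((cauchyConj N c σ X).map (ratAt A)).conjTranspose
      = (Matrix.of fun i j => T i j - ∑ k ∈ range N, X k i j • B k)
        + ∑ k ∈ range N, (X k).map fun x => x • (B k + star (B k)) := by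
    ext i j : 1
    rw [Matrix.add_apply, Matrix.add_apply, Matrix.conjTranspose_apply, Matrix.map_apply,
      ratAt_cauchyConj hu, Matrix.sum_apply, star_sum, Matrix.of_apply,
      sub_add_eq_add_sub, add_sub_assoc, ← sum_sub_distrib]
    congr 1
    refine sum_congr rfl fun k _ => ?_
    rw [Matrix.map_apply, smul_add, add_sub_cancel_left, star_smul, starRingEnd_apply, star_star]
  rw [adjoint_matrixOp, ← matrixOp_add, hdec, matrixOp_add]
  refine (ContinuousLinearMap.opNorm_add_le _ _).trans (add_le_add ?_ ?_)
  · refine (norm_matrixOp_le_sum _).trans ?_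
    refine (sum_le_sum fun i _ => sum_le_sum fun j _ => hT i j).trans (le_of_eq ?_)
    simp [mul_assoc]
  · refine norm_matrixOp_sum_smul_le _ _
      (fun k _ => smul_resolvent_add_star_nonneg (hu k) (hpos k)) X hβ (fun k _ => hX k) ?_
    have h1 : ‖∑ k ∈ range N, B k‖ ≤ 1 + ε := by
      have := norm_add_le (∑ k ∈ range N, B k - 1) 1
      rw [sub_add_cancel] at this
      have h2 : ‖(1 : H →L[ℂ] H)‖ ≤ 1 := ContinuousLinearMap.norm_id_le
      linarith
    rw [sum_add_distrib, ← star_sum]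
    refine (norm_add_le _ _).trans ?_
    rw [norm_star]; linarith

/-- The estimate of `norm_add_cauchyConj_op_le` at a complex number `z` in place of an operator.
-/
theorem norm_add_cauchyConj_scalar_le {z : ℂ} {N : ℕ} {c σ : ℕ → ℂ}
    {X : ℕ → Matrix (Fin m) (Fin n) ℂ} {β ε : ℝ} (hβ : 0 ≤ β) (hX : ∀ k, ‖X k‖ ≤ β)
    (hu : ∀ k, σ k ≠ z) (hpos : ∀ k, 0 ≤ (c k * (starRingEnd ℂ) (σ k - z)).re)
    (hone : ‖1 - ∑ k ∈ range N, c k * (σ k - z)⁻¹‖ ≤ ε) {T : Matrix (Fin m) (Fin n) ℂ}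
    (hT : ∀ i j, ‖T i j - ∑ k ∈ range N, X k i j * (c k * (σ k - z)⁻¹)‖ ≤ ε) :
    ‖T + ((cauchyConj N c σ X).map (ratAt z)).conjTranspose‖
      ≤ m * n * ε + β * (2 * (1 + ε)) := by
  set B : ℕ → ℂ := fun k => c k * (σ k - z)⁻¹
  have hu' : ∀ k, IsUnit (algebraMap ℂ ℂ (σ k) - z) := fun k =>
    IsUnit.mk0 _ (sub_ne_zero.2 (hu k))
  have hB : ∀ k, 0 ≤ (B k).re := fun k => by
    have : B k = (c k * (starRingEnd ℂ) (σ k - z)) * ((Complex.normSq (σ k - z))⁻¹ : ℝ) := by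
      simp only [B]; rw [Complex.inv_def, mul_assoc]
    rw [this, Complex.re_mul_ofReal]
    exact mul_nonneg (hpos k) (inv_nonneg.2 (Complex.normSq_nonneg _))
  have hdec : T + ((cauchyConj N c σ X).map (ratAt z)).conjTranspose
      = (Matrix.of fun i j => T i j - ∑ k ∈ range N, X k i j * B k)
        + ∑ k ∈ range N, ((2 * (B k).re : ℝ) : ℂ) • X k := by
    ext i j : 2
    rw [Matrix.add_apply, Matrix.add_apply, Matrix.conjTranspose_apply, Matrix.map_apply,
      ratAt_cauchyConj hu', Matrix.sum_apply, star_sum, Matrix.of_apply, sub_add_eq_add_sub,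
      add_sub_assoc, ← sum_sub_distrib]
    congr 1
    refine sum_congr rfl fun k _ => ?_
    have h1 : ((2 * (B k).re : ℝ) : ℂ) = B k + star (B k) := by
      rw [← starRingEnd_apply, Complex.add_conj]
    rw [Matrix.smul_apply, h1, smul_eq_mul, smul_eq_mul, smul_eq_mul, Ring.inverse_eq_inv',
      Algebra.algebraMap_self_apply, star_mul', starRingEnd_apply, star_star]
    ring
  rw [hdec]
  refine (norm_add_le _ _).trans (add_le_add ?_ ?_)
  · refine (l2_opNorm_le_sum _).trans ?_
    refine (sum_le_sum fun i _ => sum_le_sum fun j _ => hT i j).trans (le_of_eq ?_)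
    simp [mul_assoc]
  · have hterm : ∀ k ∈ range N, ‖((2 * (B k).re : ℝ) : ℂ) • X k‖ ≤ β * (2 * (B k).re) := by
      intro k _
      rw [norm_smul, Complex.norm_real, Real.norm_of_nonneg (mul_nonneg zero_le_two (hB k)),
        mul_comm]
      exact mul_le_mul_of_nonneg_right (hX k) (mul_nonneg zero_le_two (hB k))
    refine (norm_sum_le_of_le _ hterm).trans ?_
    rw [← mul_sum, ← mul_sum, ← Complex.re_sum]
    have h1 : (∑ k ∈ range N, B k).re ≤ 1 + ε := by
      have h2 := (Complex.abs_re_le_norm (1 - ∑ k ∈ range N, B k)).trans hone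
      rw [Complex.sub_re, Complex.one_re] at h2
      linarith [(abs_le.1 h2).1]
    gcongr

/-- A rational approximation `G` of the Cauchy transform of `Rᴴ`. The curve runs in a
neighbourhood of `closure Ω` where `‖R‖` is still at most `1 + η`. -/
theorem exists_conjugate {Ω : Set ℂ} (hΩo : IsOpen Ω) (hΩ : Convex ℝ Ω) (hne : Ω.Nonempty)
    (hΩb : Bornology.IsBounded Ω) {A : H →L[ℂ] H} (hA : closure (numericalRange A) ⊆ Ω)
    {R : Matrix (Fin m) (Fin n) (RatFunc ℂ)} (hR : BoundedOn Ω R 1) {ε : ℝ} (hε : 0 < ε) :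
    ∃ G : Matrix (Fin n) (Fin m) (RatFunc ℂ), BoundedOn Ω G (3 + ε) ∧
      ‖matrixOp (R.map (ratAt A)) + ContinuousLinearMap.adjoint (matrixOp (G.map (ratAt A)))‖
        ≤ 2 + ε := by
  obtain ⟨η, hη, hηε⟩ : ∃ η : ℝ, 0 < η ∧ m * n * η + (1 + η) * (2 * (1 + η)) ≤ 2 + ε := by
    have hcont : Tendsto (fun η : ℝ => m * n * η + (1 + η) * (2 * (1 + η))) (𝓝[>] 0) (𝓝 2) := by
      have : Continuous (fun η : ℝ => m * n * η + (1 + η) * (2 * (1 + η))) := by fun_prop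
      have h := this.tendsto 0
      norm_num at h
      exact h.mono_left nhdsWithin_le_nhds
    obtain ⟨η, h1, h2⟩ := ((hcont.eventually (ge_mem_nhds (by linarith : (2 : ℝ) < 2 + ε))).and
      self_mem_nhdsWithin).exists
    exact ⟨η, h2, h1⟩
  obtain ⟨w, hw⟩ := hne
  have hwC : w ∈ closure Ω := subset_closure hw
  have hC : IsCompact (closure Ω) := hΩb.isCompact_closure
  have hAΩ : numericalRange A ⊆ Ω := subset_closure.trans hA
  obtain ⟨O, hO, hΩO, hRO⟩ := hR.exists_open (b' := 1 + η) (by linarith)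
  obtain ⟨V, U, hV, hVc, hVb, hCV, hUc, hVU, hUO⟩ :=
    exists_convex_neighborhoods hC hΩ.closure hO hΩO
  obtain ⟨p, hp⟩ := exists_boundarySampling hV hVc hVb (hCV hwC)
  have hpV : ∀ N j, p N j ∉ V := fun N j => notMem_of_mem_frontier hV (hp.mem_frontier N j)
  have hpO : ∀ N j, p N j ∈ O := fun N j =>
    hUO (hVU (frontier_subset_closure (hp.mem_frontier N j)))
  have ha : ∀ z ∈ frontier V, ∀ s ∈ Set.Icc (0 : ℝ) 1, IsUnit (algebraMap ℂ (H →L[ℂ] H) (z - w)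
      - (s : ℂ) • (A - algebraMap ℂ (H →L[ℂ] H) w)) := fun z hz s hs =>
    isUnit_sub_of_notMem isClosed_closure hΩ.closure (hAΩ.trans subset_closure) hwC
      (fun h => notMem_of_mem_frontier hV hz (hCV h)) hs
  have hRU : ∀ i j, NoPoleOn (R i j) U := fun i j z hz => hRO.noPole i j z (hUO hz)
  have hRA : ∀ i j, R i j ∈ regularAt A := fun i j =>
    mem_regularAt_of_noPoleOn hΩo hΩ ⟨w, hw⟩ hA (hR.noPole i j)
  obtain ⟨d, hd, hdV⟩ := hC.exists_thickening_subset_open hV hCV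
  have hdist : ∀ N j, ∀ z ∈ closure Ω, d ≤ ‖z - p N j‖ := by
    intro N j z hz
    by_contra hlt
    refine hpV N j (hdV (Metric.mem_thickening_iff.2 ⟨z, hz, ?_⟩))
    rw [dist_comm, dist_eq_norm]; exact not_le.1 hlt
  have hOne : NoPoleOn (1 : RatFunc ℂ) U := fun z _ => by simp
  have hOneEval : ∀ z : ℂ, ratEval (1 : RatFunc ℂ) z = 1 := fun z => by simp [ratEval]
  have e1 : ∀ᶠ N in atTop, ∀ i j, ‖ratAt A (R i j) - ∑ k ∈ range N, ratEval (R i j) (p N k) •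
      cauchyWeight p N k • Ring.inverse (algebraMap ℂ (H →L[ℂ] H) (p N k) - A)‖ ≤ η :=
    eventually_all.2 fun i => eventually_all.2 fun j => by
      filter_upwards [Metric.tendsto_nhds.1
        (hp.tendsto_sum_ratAt hVc hVb hUc hVU ha (hRU i j) (hRA i j)) η hη] with N hN
      rw [norm_sub_rev, ← dist_eq_norm]; exact hN.le
  have e2 : ∀ᶠ N in atTop, ‖∑ k ∈ range N, cauchyWeight p N k •
      Ring.inverse (algebraMap ℂ (H →L[ℂ] H) (p N k) - A) - 1‖ ≤ η := by
    filter_upwards [Metric.tendsto_nhds.1 (hp.tendsto_sum_one hVb ha) η hη] with N hN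
    rw [← dist_eq_norm]; exact hN.le
  have e3 : ∀ᶠ N in atTop, ∀ i j, ∀ z ∈ closure Ω, ‖ratEval (R i j) z -
      ∑ k ∈ range N, ratEval (R i j) (p N k) * (cauchyWeight p N k * (p N k - z)⁻¹)‖ ≤ η :=
    eventually_all.2 fun i => eventually_all.2 fun j =>
      hp.eventually_uniform hV hVc hVb hUc hVU hC hCV (hCV hwC) (hRU i j) hη
  have e4 := hp.eventually_uniform hV hVc hVb hUc hVU hC hCV (hCV hwC) hOne hη
  obtain ⟨N, h1, h2, h3, h4, h5, hN3⟩ := (e1.and (e2.and (e3.and (e4.and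
    ((hp.eventually_step_lt hd).and (eventually_ge_atTop 3)))))).exists
  simp only [hOneEval, one_mul] at h4
  have hpos : ∀ k, ∀ z ∈ Ω, 0 ≤ (cauchyWeight p N k * (starRingEnd ℂ) (p N k - z)).re := by
    intro k z hz
    have h := left_of_chord hV hVc hΩ.closure hCV hwC (hp.mem_frontier N k)
      (hp.mem_frontier N (k + 1)) (fun z hz => (h5 k).trans_le (hdist N k z hz))
      (hp.turning N k hN3) z (subset_closure hz)
    -- `Re (Δ conj(p - z) / (2πi))` is a positive multiple of `Im ((z - p) conj Δ)`.
    have h6 : cauchyWeight p N k * (starRingEnd ℂ) (p N k - z) = ((2 * Real.pi)⁻¹ : ℝ) *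
        (-Complex.I * ((p N (k + 1) - p N k) * (starRingEnd ℂ) (p N k - z))) := by
      rw [cauchyWeight, ← Complex.inv_I]
      have : (Real.pi : ℂ) ≠ 0 := by exact_mod_cast Real.pi_ne_zero
      push_cast; field_simp
    rw [h6, Complex.re_ofReal_mul]
    refine mul_nonneg (by positivity) ?_
    refine h.le.trans (le_of_eq ?_)
    simp only [Complex.mul_re, Complex.mul_im, Complex.conj_re, Complex.conj_im, Complex.sub_re,
      Complex.sub_im, Complex.neg_re, Complex.neg_im, Complex.I_re, Complex.I_im]
    ring
  have hX : ∀ k, ‖R.map (ratAt (p N k))‖ ≤ 1 + η := fun k => hRO.norm_le _ (hpO N k)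
  have hz : ∀ k, ∀ z ∈ Ω, p N k ≠ z := fun k z hz h => hpV N k (h ▸ hCV (subset_closure hz))
  refine ⟨cauchyConj N (cauchyWeight p N) (p N) fun k => R.map (ratAt (p N k)), ⟨?_, ?_⟩, ?_⟩
  · intro i j
    exact noPoleOn_iff.2 fun z hzΩ => cauchyConj_mem
      (fun k => IsUnit.mk0 _ (sub_ne_zero.2 (hz k z hzΩ))) _ _
  · intro z hzΩ
    have h := norm_add_cauchyConj_scalar_le (X := fun k => R.map (ratAt (p N k)))
      (T := R.map (ratAt z)) (by linarith) hX (fun k => hz k z hzΩ) (fun k => hpos k z hzΩ)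
      (h4 z (subset_closure hzΩ)) (fun i j => by
        have := h3 i j z (subset_closure hzΩ)
        simpa only [ratEval_eq_ratAt, Matrix.map_apply] using this)
    rw [← Matrix.l2_opNorm_conjTranspose]
    have h7 := norm_sub_le (R.map (ratAt z) + ((cauchyConj N (cauchyWeight p N) (p N)
      fun k => R.map (ratAt (p N k))).map (ratAt z)).conjTranspose) (R.map (ratAt z))
    rw [add_sub_cancel_left] at h7
    linarith [hR.norm_le z hzΩ]
  · refine (norm_add_cauchyConj_op_le (by linarith) hX (hp.isUnit_sub ha N)
      (fun k v hv => hpos k v (hAΩ hv)) h2 fun i j => ?_).trans hηε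
    have := h1 i j
    simpa only [ratEval_eq_ratAt, Matrix.map_apply] using this

end Main

/-! ### The bound -/

section Bound

variable {H : Type u} [NormedAddCommGroup H] [InnerProductSpace ℂ H] [CompleteSpace H]
variable {m n : ℕ} {Ω : Set ℂ}

theorem BoundedOn.mul {l : ℕ} {R : Matrix (Fin l) (Fin m) (RatFunc ℂ)}
    {S : Matrix (Fin m) (Fin n) (RatFunc ℂ)} {b c : ℝ} (hb : 0 ≤ b) (hR : BoundedOn Ω R b)
    (hS : BoundedOn Ω S c) : BoundedOn Ω (R * S) (b * c) where
  noPole i j := noPoleOn_iff.2 fun z hz => mul_mem_regularAt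
    (fun i j => noPoleOn_iff.1 (hR.noPole i j) z hz)
    (fun i j => noPoleOn_iff.1 (hS.noPole i j) z hz) i j
  norm_le z hz := by
    rw [map_ratAt_mul (fun i j => noPoleOn_iff.1 (hR.noPole i j) z hz)
      (fun i j => noPoleOn_iff.1 (hS.noPole i j) z hz)]
    exact (Matrix.l2_opNorm_mul _ _).trans
      (mul_le_mul (hR.norm_le z hz) (hS.norm_le z hz) (norm_nonneg _) hb)

omit [CompleteSpace H] in
theorem BoundedOn.norm_matrixOp_le {A : H →L[ℂ] H} {K : ℝ}
    (hA : ∀ r : RatFunc ℂ, NoPoleOn r Ω → r ∈ regularAt A)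
    (hK : ∀ R : Matrix (Fin m) (Fin n) (RatFunc ℂ), BoundedOn Ω R 1 →
      ‖matrixOp (R.map (ratAt A))‖ ≤ K)
    {R : Matrix (Fin m) (Fin n) (RatFunc ℂ)} {b : ℝ} (hb : 0 < b) (hR : BoundedOn Ω R b) :
    ‖matrixOp (R.map (ratAt A))‖ ≤ b * K := by
  have hnorm : ‖(b⁻¹ : ℂ)‖ = b⁻¹ := by
    rw [norm_inv, Complex.norm_real, Real.norm_of_nonneg hb.le]
  have h := hK (R.map fun r => RatFunc.C (b⁻¹ : ℂ) * r)
    ⟨fun i j => noPoleOn_iff.2 fun z hz => mul_mem (C_mem_regularAt z _)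
      (noPoleOn_iff.1 (hR.noPole i j) z hz), fun z hz => by
      rw [map_ratAt_C_mul fun i j => noPoleOn_iff.1 (hR.noPole i j) z hz, norm_smul, hnorm,
        inv_mul_le_iff₀ hb, mul_one]
      exact hR.norm_le z hz⟩
  rw [map_ratAt_C_mul fun i j => hA _ (hR.noPole i j)] at h
  have hsmul : matrixOp (R.map (ratAt A))
      = (b : ℂ) • matrixOp ((b⁻¹ : ℂ) • R.map (ratAt A)) := by
    have : (b : ℂ) ≠ 0 := by exact_mod_cast hb.ne'
    ext x i
    simp only [matrixOp_apply, smul_apply, PiLp.smul_apply, Matrix.smul_apply, ← smul_sum,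
      smul_smul, mul_inv_cancel₀ this, one_smul]
  rw [hsmul]
  refine (ContinuousLinearMap.opNorm_smul_le _ _).trans ?_
  rw [Complex.norm_real, Real.norm_of_nonneg hb.le]
  exact mul_le_mul_of_nonneg_left h hb.le

/-- Expansion of `T T⋆ T T⋆`, in which one factor is written as `T⋆ = (T + G⋆)⋆ - G`. -/
theorem norm_pow_four_le {X Y : Type*} [NormedAddCommGroup X] [InnerProductSpace ℂ X]
    [CompleteSpace X] [NormedAddCommGroup Y] [InnerProductSpace ℂ Y] [CompleteSpace Y]
    (T : X →L[ℂ] Y) (G : Y →L[ℂ] X) :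
    ‖T‖ ^ 4 ≤ ‖T + ContinuousLinearMap.adjoint G‖ * ‖T‖ ^ 3 + ‖T ∘L G ∘L T‖ * ‖T‖ := by
  set S := ContinuousLinearMap.adjoint T
  set Z := ContinuousLinearMap.adjoint (T + ContinuousLinearMap.adjoint G) with hZ
  have hS : ‖S‖ = ‖T‖ := LinearIsometryEquiv.norm_map _ T
  have hZn : ‖Z‖ = ‖T + ContinuousLinearMap.adjoint G‖ := LinearIsometryEquiv.norm_map _ _
  have hZS : S = Z - G := by
    rw [hZ, map_add, ContinuousLinearMap.adjoint_adjoint, add_sub_cancel_right]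
  have hsq : ‖T ∘L S‖ = ‖T‖ * ‖T‖ := by
    have := ContinuousLinearMap.norm_adjoint_comp_self S
    rwa [ContinuousLinearMap.adjoint_adjoint, hS] at this
  have hself : ContinuousLinearMap.adjoint (T ∘L S) = T ∘L S := by
    rw [ContinuousLinearMap.adjoint_comp, ContinuousLinearMap.adjoint_adjoint]
  have hfour : ‖(T ∘L S) ∘L (T ∘L S)‖ = ‖T‖ ^ 4 := by
    have := ContinuousLinearMap.norm_adjoint_comp_self (T ∘L S)
    rw [hself, hsq] at this
    rw [this]; ring
  have hdec : (T ∘L S) ∘L (T ∘L S) = (T ∘L Z) ∘L (T ∘L S) - (T ∘L G ∘L T) ∘L S := by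
    conv_lhs => rw [hZS]
    rw [← hZS]
    ext x
    simp only [hZS, sub_apply, ContinuousLinearMap.comp_apply, map_sub]
    abel
  rw [← hfour, hdec]
  refine (norm_sub_le _ _).trans (add_le_add ?_ ?_)
  · refine (ContinuousLinearMap.opNorm_comp_le _ _).trans ?_
    rw [hsq]
    have := mul_le_mul_of_nonneg_right (ContinuousLinearMap.opNorm_comp_le T Z)
      (by positivity : 0 ≤ ‖T‖ * ‖T‖)
    rw [hZn] at this
    linarith
  · refine (ContinuousLinearMap.opNorm_comp_le _ _).trans ?_
    rw [hS]

/-- The supremum over the matrices of a fixed size is used because `S * (G * S)` has the size of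
`S`. -/
theorem norm_matrixOp_le_three (hΩo : IsOpen Ω) (hΩ : Convex ℝ Ω) (hne : Ω.Nonempty)
    (hΩb : Bornology.IsBounded Ω) {A : H →L[ℂ] H} (hA : closure (numericalRange A) ⊆ Ω)
    {R : Matrix (Fin m) (Fin n) (RatFunc ℂ)} (hR : BoundedOn Ω R 1) :
    ‖matrixOp (R.map (ratAt A))‖ ≤ 3 := by
  have hreg : ∀ r : RatFunc ℂ, NoPoleOn r Ω → r ∈ regularAt A :=
    fun r hr => mem_regularAt_of_noPoleOn hΩo hΩ hne hA hr
  set T : Set ℝ := {t | ∃ R : Matrix (Fin m) (Fin n) (RatFunc ℂ), BoundedOn Ω R 1 ∧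
    ‖matrixOp (R.map (ratAt A))‖ = t} with hT
  have hTne : T.Nonempty := ⟨_, R, hR, rfl⟩
  have hTb : BddAbove T := by
    obtain ⟨B, hB⟩ := exists_norm_ratOp_le hΩo hΩ hne hA
    refine ⟨∑ _i : Fin m, ∑ _j : Fin n, B, ?_⟩
    rintro _ ⟨S, hS, rfl⟩
    exact (norm_matrixOp_le_sum _).trans (sum_le_sum fun i _ => sum_le_sum fun j _ =>
      hB _ (hS.noPole i j) fun z hz => hS.norm_entry_le hz i j)
  set K : ℝ := sSup T with hK
  have hKle : ∀ S : Matrix (Fin m) (Fin n) (RatFunc ℂ), BoundedOn Ω S 1 →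
      ‖matrixOp (S.map (ratAt A))‖ ≤ K := fun S hS => le_csSup hTb ⟨S, hS, rfl⟩
  refine (hKle R hR).trans ?_
  -- The inequality is closed, so it passes from the norms `‖S(A)‖` to their supremum.
  have hineq : ∀ ε : ℝ, 0 < ε → K ^ 4 ≤ (2 + ε) * K ^ 3 + (3 + ε) * K * K := by
    intro ε hε
    have hcl : IsClosed {t : ℝ | t ^ 4 ≤ (2 + ε) * t ^ 3 + (3 + ε) * K * t} :=
      isClosed_le (by fun_prop) (by fun_prop)
    refine (closure_minimal ?_ hcl) (csSup_mem_closure hTne hTb)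
    rintro _ ⟨S, hS, rfl⟩
    obtain ⟨G, hG, hSG⟩ := exists_conjugate hΩo hΩ hne hΩb hA hS hε
    have hSreg : ∀ i j, S i j ∈ regularAt A := fun i j => hreg _ (hS.noPole i j)
    have hGreg : ∀ i j, G i j ∈ regularAt A := fun i j => hreg _ (hG.noPole i j)
    have hprod : BoundedOn Ω (S * (G * S)) (3 + ε) := by
      have := hS.mul zero_le_one (hG.mul (by linarith) hS)
      rwa [mul_one, one_mul] at this
    have h1 := hprod.norm_matrixOp_le hreg hKle (by linarith)
    rw [map_ratAt_mul hSreg (mul_mem_regularAt hGreg hSreg), map_ratAt_mul hGreg hSreg,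
      matrixOp_mul, matrixOp_mul] at h1
    refine (norm_pow_four_le (matrixOp (S.map (ratAt A))) (matrixOp (G.map (ratAt A)))).trans ?_
    exact add_le_add (mul_le_mul_of_nonneg_right hSG (by positivity))
      (mul_le_mul_of_nonneg_right h1 (norm_nonneg _))
  by_contra! h3
  -- For `ε = (K - 3) / 2` the error terms absorb half of `K² (K - 3) (K + 1)`.
  have h := hineq ((K - 3) / 2) (by linarith)
  have hfac : K ^ 2 * ((K - 3) * (K + 1)) ≤ 0 := by nlinarith
  have : 0 < K ^ 2 * ((K - 3) * (K + 1)) :=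
    mul_pos (by positivity) (mul_pos (by linarith) (by linarith))
  linarith

end Bound

theorem spectralConst_le_spectralConstCB (Ω : Set ℂ) :
    spectralConst.{u} Ω ≤ spectralConstCB.{u} Ω := by
  refine iSup_le fun H => iSup_le fun i₁ => iSup_le fun i₂ => iSup_le fun i₃ => iSup_le fun A =>
    iSup_le fun hA => iSup_le fun r => iSup_le fun hr => iSup_le fun hr1 => ?_
  let R : Matrix (Fin 1) (Fin 1) (RatFunc ℂ) := Matrix.of fun _ _ => r
  have h1 : ∀ z ∈ Ω, ‖(R.map fun r => ratEval r z)‖ ≤ 1 := fun z hz => by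
    refine (l2_opNorm_le_sum _).trans ?_
    simpa [R] using hr1 z hz
  have h2 : ‖ratOp r A‖ₑ ≤ ‖matrixOp (R.map fun r => ratOp r A)‖ₑ :=
    enorm_le_iff_norm_le.2 (norm_entry_le_norm_matrixOp (R.map fun r => ratOp r A) 0 0)
  refine h2.trans ?_
  exact le_iSup_of_le H <| le_iSup_of_le i₁ <| le_iSup_of_le i₂ <| le_iSup_of_le i₃ <|
    le_iSup_of_le A <| le_iSup_of_le hA <| le_iSup_of_le 1 <| le_iSup_of_le 1 <|
    le_iSup_of_le R <| le_iSup_of_le (fun _ _ => hr) <| le_iSup_of_le h1 le_rfl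

theorem spectralConstCB_le_three {Ω : Set ℂ} (hΩo : IsOpen Ω) (hΩ : Convex ℝ Ω) (hne : Ω.Nonempty)
    (hΩb : Bornology.IsBounded Ω) : spectralConstCB.{u} Ω ≤ 3 := by
  refine iSup_le fun H => iSup_le fun _ => iSup_le fun _ => iSup_le fun _ => iSup_le fun A =>
    iSup_le fun hA => iSup_le fun m => iSup_le fun n => iSup_le fun R => iSup_le fun hR =>
    iSup_le fun hR1 => ?_
  have hbound : BoundedOn Ω R 1 := ⟨hR, fun z hz => by
    have := hR1 z hz
    simpa only [ratEval_eq_ratAt] using this⟩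
  have h : ‖matrixOp (R.map fun r => ratOp r A)‖ ≤ 3 :=
    norm_matrixOp_le_three hΩo hΩ hne hΩb hA hbound
  rw [← ofReal_norm]
  exact (ENNReal.ofReal_le_ofReal h).trans (by simp)

end ConvexSpectral

theorem mainTheorem1 (Ω : Set ℂ) (hopen : IsOpen Ω) (hconv : Convex ℝ Ω)
    (hne : Ω.Nonempty) (hbdd : Bornology.IsBounded Ω) :
    ConvexSpectral.spectralConst.{u} Ω ≤ ConvexSpectral.spectralConstCB.{u} Ω ∧
      ConvexSpectral.spectralConstCB.{u} Ω ≤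
        2 + ENNReal.ofReal Real.pi + ConvexSpectral.boundaryLogVariation Ω := by
  refine ⟨ConvexSpectral.spectralConst_le_spectralConstCB Ω,
    (ConvexSpectral.spectralConstCB_le_three hopen hconv hne hbdd).trans ?_⟩
  refine le_trans ?_ le_self_add
  have h1 : (1 : ℝ≥0∞) ≤ ENNReal.ofReal Real.pi := by
    rw [← ENNReal.ofReal_one]
    exact ENNReal.ofReal_le_ofReal (by linarith [Real.pi_gt_three])
  calc (3 : ℝ≥0∞) = 2 + 1 := by norm_num
    _ ≤ 2 + ENNReal.ofReal Real.pi := by gcongr
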